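/- Let $L$ be a Lie conformal algebra over $\mathbb{C}$, with $\lambda$-bracket $[a_\lambda b]\in L[\lambda]$, that is free of finite rank $N$ as a $\mathbb{C}[\partial]$-module, with $\mathbb{C}[\partial]$-basis $u^1,\dots,u^N$. Let $R\in\mathrm{End}_{\mathbb{C}}(L)$ commute with $\partial$, and put $[a_\lambda b]_R:=[R(a)_\lambda b]+[a_\lambda R(b)]$. The endomorphism $R$ is called a *classical $R$-matrix* if $[\cdot_\lambda\cdot]_R$ is again a Lie conformal algebra bracket on the $\mathbb{C}[\partial]$-module $L$. Let $\mathcal{A}=\mathbb{C}[u^{\alpha,(n)}: 1\le\alpha\le N,\ n\ge 0]$, with $\partial u^{\alpha,(n)}=u^{\alpha,(n+1)}$, be the algebra of functions on the arc space of $\mathbb{A}^N$. A $\lambda$-bracket on $L$ is extended to $\mathcal{A}$ by the Master Formula $$\{f_\lambda g\}=\sum_{\alpha,\beta,m,n}\frac{\partial g}{\partial u^{\beta,(n)}}(\lambda+\partial)^n\{u^\alpha{}_{\lambda+\partial}u^\beta\}_\to(-\lambda-\partial)^m\frac{\partial f}{\partial u^{\alpha,(m)}} ;$$ write $\{\cdot_\lambda\cdot\}$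 and $\{\cdot_\lambda\cdot\}_R$ for the extensions of the two brackets. Let $\hat{\mathcal{A}}=\mathcal{A}\otimes\bigwedge(\theta_\alpha^{(n)}: 1\le\alpha\le N,\ n\ge 0)$, with $\theta_\alpha=\theta_\alpha^{(0)}$ and $\partial\theta_\alpha^{(n)}=\theta_\alpha^{(n+1)}$, be the algebra of functions on the arc space of $T^*[1]\mathbb{A}^N$, graded by the degree in the $\theta_\alpha^{(n)}$. It carries the degree $-1$ $\lambda$-bracket determined by $\{u^\alpha{}_\lambda\theta_\beta\}=\delta^\alpha_\beta$, $\{u^\alpha{}_\lambda u^\beta\}=\{\theta_{\alpha\,\lambda}\theta_\beta\}=0$, sesquilinearity, $\{f_\lambda gh\}=\{f_\lambda g\}h+(-1)^{(|f|+1)|g|}g\{f_\lambda h\}$ and $\{f_\lambda g\}=-(-1)^{(|f|+1)(|g|+1)}\{g_{-\lambda-\partial}f\}$. Let $\hat{\mathcal{F}}_{cl}=\hat{\mathcal{A}}/\partial\hat{\mathcal{A}}$, with quotient map $\int$ and bracket $[\int f,\int g]=\int\{f_\lambda g\}|_{\lambda=0}$ (this is well defined). Put $$P=\sum_{\alpha,\beta}\theta_\alpha\{u^\beta{}_\partial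 u^\alpha\}_{\to}\theta_\beta,\qquad P_R=\sum_{\alpha,\beta}\theta_\alpha\{u^\beta{}_\partial u^\alpha\}_{R,\to}\theta_\beta,$$ where the arrow means that $\sum_s c_s\lambda^s$ becomes the operator $\sum_s c_s\partial^s$, here acting on $\theta_\beta$. Then: 1. The map $u^\alpha\mapsto u^{\alpha,(0)}$ induces an isomorphism of differential algebras $S(L)\cong\mathcal{A}$, and under it the bracket $\{\cdot_\lambda\cdot\}$ on $\mathcal{A}$ restricts to the given $\lambda$-bracket on $L$. 2. If for some $\kappa\in\mathbb{C}$ the map $R$ satisfies the modified classical Yang–Baxter equation $[R(a)_\lambda R(b)]-R([a_\lambda b]_R)=-\kappa[a_\lambda b]$ for all $a,b\in L$ (with $R$ applied to the coefficients of the powers of $\lambda$), then $R$ is a classical $R$-matrix. 3. $P_R$ has degree $2$, and $R$ is a classical $R$-matrix if and only if $[\int P_R,\int P_R]=0$. 4. $[\int P,\int P]=0$; and, with $d_P=[\int P,-]$, $R$ is a classical $R$-matrix if and only if $\Theta_R=\int(P_R-P)$ is a Maurer–Cartan element of the dg Lie algebra $(\hat{\mathcal{F}}_{cl},[-,-],d_P)$,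 that is, $\Theta_R$ has degree $2$ and $d_P\Theta_R+\tfrac12[\Theta_R,\Theta_R]=0$. -/

import Mathlib

open scoped TensorProduct Polynomial

noncomputable section

namespace ConformalR

/-! ### Polynomials in a formal variable with coefficients in a vector space

`ℕ →₀ M` is the space `M[λ]`: the value at `n` is the coefficient of `λ ^ n`. -/

section Lambda

variable {M M' W : Type*} [AddCommGroup M] [Module ℂ M] [AddCommGroup M'] [Module ℂ M']
  [AddCommGroup W] [Module ℂ W]

/-- Multiplication by the formal variable on `M[λ]`. -/
def lam : (ℕ →₀ M) →ₗ[ℂ] (ℕ →₀ M) := Finsupp.lmapDomain M ℂ Nat.succ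

/-- A linear map applied to every coefficient. -/
def coeffwise (f : M →ₗ[ℂ] M') : (ℕ →₀ M) →ₗ[ℂ] (ℕ →₀ M') := Finsupp.mapRange.linearMap f

/-- `subst T j (∑ λ ^ n cₙ) = ∑ T ^ n (j cₙ)`: the variable is replaced by the operator `T`,
which acts on the (embedded) coefficients. -/
def subst (T : W →ₗ[ℂ] W) (j : M →ₗ[ℂ] W) : (ℕ →₀ M) →ₗ[ℂ] W :=
  Finsupp.lsum ℂ fun n => (T ^ n) ∘ₗ j

/-- The operator `λ + ∂` on `M[λ]`. -/
def lamAdd (d : M →ₗ[ℂ] M) : (ℕ →₀ M) →ₗ[ℂ] (ℕ →₀ M) := lam + coeffwise d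

/-- `p(λ) ↦ p(-λ-∂)`, where `∂` acts on the coefficients of `p`. -/
def negLamSub (d : M →ₗ[ℂ] M) : (ℕ →₀ M) →ₗ[ℂ] (ℕ →₀ M) :=
  subst (-lamAdd d) (Finsupp.lsingle 0)

end Lambda

/-! ### Lie conformal algebras and classical R-matrices -/

section LieConformal

variable {L : Type*} [AddCommGroup L] [Module ℂ L] [Module ℂ[X] L] [IsScalarTower ℂ ℂ[X] L]

variable (L) in
/-- The translation operator `∂` of a `ℂ[∂]`-module. -/
def transl : L →ₗ[ℂ] L := (LinearMap.lsmul ℂ[X] L Polynomial.X).restrictScalars ℂ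

/-- `B a b = [a_λ b]` makes the `ℂ[∂]`-module `L` a Lie conformal algebra. The Jacobi identity
is an identity in `L[λ][μ] = ℕ →₀ ℕ →₀ L`, with inner variable `λ` and outer variable `μ`. -/
structure IsLieConformal (B : L →ₗ[ℂ] L →ₗ[ℂ] (ℕ →₀ L)) : Prop where
  /-- `[∂a_λ b] = -λ[a_λ b]` -/
  sesq_left : ∀ a b, B (transl L a) b = -lam (B a b)
  /-- `[a_λ ∂b] = (λ + ∂)[a_λ b]` -/
  sesq_right : ∀ a b, B a (transl L b) = lamAdd (transl L) (B a b)
  /-- `[b_λ a] = -[a_{-λ-∂} b]` -/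
  skew : ∀ a b, B b a = -negLamSub (transl L) (B a b)
  /-- `[a_λ [b_μ c]] = [[a_λ b]_{λ+μ} c] + [b_μ [a_λ c]]` -/
  jacobi : ∀ a b c,
    coeffwise (B a) (B b c) =
      subst (coeffwise (lam (M := L)))
          (subst (coeffwise (lam (M := L)) + lam (M := ℕ →₀ L))
            (Finsupp.lsingle 0 ∘ₗ Finsupp.lsingle 0) ∘ₗ B.flip c)
          (B a b) +
        subst (coeffwise (lam (M := L))) (coeffwise (Finsupp.lsingle 0) ∘ₗ B b) (B a c)

/-- The deformed bracket `[a_λ b]_R = [R a_λ b] + [a_λ R b]`. -/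
def bracketR (B : L →ₗ[ℂ] L →ₗ[ℂ] (ℕ →₀ L)) (R : L →ₗ[ℂ] L) : L →ₗ[ℂ] L →ₗ[ℂ] (ℕ →₀ L) :=
  B ∘ₗ R + B.compl₂ R

/-- `R` is a classical R-matrix: the deformed bracket is again a Lie conformal algebra bracket
on the same `ℂ[∂]`-module. -/
def IsClassicalRMatrix (B : L →ₗ[ℂ] L →ₗ[ℂ] (ℕ →₀ L)) (R : L →ₗ[ℂ] L) : Prop :=
  IsLieConformal (bracketR B R)

/-- The modified classical Yang–Baxter equation with constant `κ`:
`[R a_λ R b] - R([R a_λ b] + [a_λ R b]) = -κ [a_λ b]` (for `κ = 0` the unmodified one). -/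
def ModifiedCYBE (κ : ℂ) (B : L →ₗ[ℂ] L →ₗ[ℂ] (ℕ →₀ L)) (R : L →ₗ[ℂ] L) : Prop :=
  ∀ a b, B (R a) (R b) - coeffwise R (bracketR B R a b) = -(κ • B a b)

variable (L) in
/-- `S(L) → S(L)[ε]`, `x ↦ x + ε ∂x` on `L`. -/
def symDual : SymmetricAlgebra ℂ L →ₐ[ℂ] DualNumber (SymmetricAlgebra ℂ L) :=
  SymmetricAlgebra.lift
    ((TrivSqZeroExt.inlAlgHom ℂ (SymmetricAlgebra ℂ L) (SymmetricAlgebra ℂ L)).toLinearMap ∘ₗ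
        SymmetricAlgebra.ι ℂ L +
      (TrivSqZeroExt.inrHom (SymmetricAlgebra ℂ L) (SymmetricAlgebra ℂ L)).restrictScalars ℂ ∘ₗ
        SymmetricAlgebra.ι ℂ L ∘ₗ transl L)

theorem fst_symDual (x : SymmetricAlgebra ℂ L) : (symDual L x).fst = x := by
  have : (TrivSqZeroExt.fstHom ℂ (SymmetricAlgebra ℂ L) (SymmetricAlgebra ℂ L)).comp (symDual L) =
      AlgHom.id ℂ _ := by
    apply SymmetricAlgebra.algHom_ext
    ext x
    simp [symDual]
  exact DFunLike.congr_fun this x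

variable (L) in
/-- The derivation of `S(L)` which extends `∂` on `L`. -/
def symDer : Derivation ℂ (SymmetricAlgebra ℂ L) (SymmetricAlgebra ℂ L) :=
  Derivation.mk'
    ((TrivSqZeroExt.sndHom (SymmetricAlgebra ℂ L) (SymmetricAlgebra ℂ L)).restrictScalars ℂ ∘ₗ
      (symDual L).toLinearMap)
    (by intro a b; simp [fst_symDual, mul_comm])

end LieConformal

/-! ### The arc space of affine space and of its shifted cotangent bundle -/

section Jets

/-- Functions on the arc space of `𝔸ᴺ`: polynomials in the jet coordinates `u^{α,(n)}`. -/
abbrev ArcAlg (N : ℕ) : Type := MvPolynomial (Fin N × ℕ) ℂ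

/-- The exterior algebra on the odd jet coordinates `θ_α^{(n)}`. -/
abbrev OddAlg (N : ℕ) : Type := ExteriorAlgebra ℂ ((Fin N × ℕ) →₀ ℂ)

/-- Functions on the arc space of `T*[1]𝔸ᴺ`. -/
abbrev HatAlg (N : ℕ) : Type := OddAlg N ⊗[ℂ] ArcAlg N

variable {N : ℕ}

/-- The translation operator on the arc space: `∂ u^{α,(n)} = u^{α,(n+1)}`. -/
def arcDer (N : ℕ) : Derivation ℂ (ArcAlg N) (ArcAlg N) :=
  MvPolynomial.mkDerivation ℂ fun i => MvPolynomial.X (i.1, i.2 + 1)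

/-- The odd coordinate `θ_α^{(n)}`. -/
def oddVar (i : Fin N × ℕ) : OddAlg N := ExteriorAlgebra.ι ℂ (Finsupp.single i 1)

/-- The shift `θ_α^{(n)} ↦ θ_α^{(n+1)}` on linear combinations of odd coordinates. -/
def oddShift (N : ℕ) : ((Fin N × ℕ) →₀ ℂ) →ₗ[ℂ] ((Fin N × ℕ) →₀ ℂ) :=
  Finsupp.lmapDomain ℂ ℂ fun i => (i.1, i.2 + 1)

/-- The algebra map `x ↦ x + ε ∂x` to dual numbers, `∂ θ_α^{(n)} = θ_α^{(n+1)}`. -/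
def oddDual (N : ℕ) : OddAlg N →ₐ[ℂ] DualNumber (OddAlg N) :=
  ExteriorAlgebra.lift ℂ
    ⟨(TrivSqZeroExt.inlAlgHom ℂ (OddAlg N) (OddAlg N)).toLinearMap ∘ₗ ExteriorAlgebra.ι ℂ +
      (TrivSqZeroExt.inrHom (OddAlg N) (OddAlg N)).restrictScalars ℂ ∘ₗ
        ExteriorAlgebra.ι ℂ ∘ₗ oddShift N, by
      intro m
      ext
      · simp
      · simp [ExteriorAlgebra.ι_add_mul_swap]⟩

/-- The even derivation of the odd coordinate algebra with `∂ θ_α^{(n)} = θ_α^{(n+1)}`. -/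
def oddDer (N : ℕ) : OddAlg N →ₗ[ℂ] OddAlg N :=
  (TrivSqZeroExt.sndHom (OddAlg N) (OddAlg N)).restrictScalars ℂ ∘ₗ (oddDual N).toLinearMap

/-- The translation operator `∂` on functions on the arc space of `T*[1]𝔸ᴺ`. -/
def hatDer (N : ℕ) : HatAlg N →ₗ[ℂ] HatAlg N :=
  (oddDer N).rTensor (ArcAlg N) + (arcDer N).toLinearMap.lTensor (OddAlg N)

/-- `∂/∂u^{α,(n)}`. -/
def dU (i : Fin N × ℕ) : HatAlg N →ₗ[ℂ] HatAlg N :=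
  (MvPolynomial.pderiv i).toLinearMap.lTensor (OddAlg N)

/-- The left derivative `∂/∂θ_α^{(n)}` on the odd coordinate algebra. -/
def dOdd (i : Fin N × ℕ) : OddAlg N →ₗ[ℂ] OddAlg N :=
  CliffordAlgebra.contractLeft (Q := (0 : QuadraticForm ℂ ((Fin N × ℕ) →₀ ℂ))) (Finsupp.lapply i)

/-- The left derivative `∂/∂θ_α^{(n)}`. -/
def dTheta (i : Fin N × ℕ) : HatAlg N →ₗ[ℂ] HatAlg N := (dOdd i).rTensor (ArcAlg N)

/-- `f ↦ (-1)^{|f|} f`. -/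
def parity (N : ℕ) : HatAlg N →ₗ[ℂ] HatAlg N :=
  (CliffordAlgebra.involute (Q := (0 : QuadraticForm ℂ ((Fin N × ℕ) →₀ ℂ)))).toLinearMap.rTensor
    (ArcAlg N)

/-- The elements of degree `p` in the odd coordinates. -/
def hatDeg (N p : ℕ) : Submodule ℂ (HatAlg N) :=
  LinearMap.range ((⋀[ℂ]^p ((Fin N × ℕ) →₀ ℂ)).subtype.rTensor (ArcAlg N))

/-! #### Leibniz rules and commutation relations -/

theorem fst_oddDual (x : OddAlg N) : (oddDual N x).fst = x := by
  have : (TrivSqZeroExt.fstHom ℂ (OddAlg N) (OddAlg N)).comp (oddDual N) = AlgHom.id ℂ _ := by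
    apply ExteriorAlgebra.hom_ext
    ext x
    simp [oddDual]
  exact DFunLike.congr_fun this x

theorem oddDer_mul (x y : OddAlg N) : oddDer N (x * y) = x * oddDer N y + oddDer N x * y := by
  simp [oddDer, fst_oddDual]

theorem oddDer_ι (v : (Fin N × ℕ) →₀ ℂ) :
    oddDer N (ExteriorAlgebra.ι ℂ v) = ExteriorAlgebra.ι ℂ (oddShift N v) := by
  simp [oddDer, oddDual]

theorem oddDer_algebraMap (r : ℂ) : oddDer N (algebraMap ℂ _ r) = 0 := by
  simp [oddDer, TrivSqZeroExt.algebraMap_eq_inl']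

theorem hatDer_tmul (x : OddAlg N) (p : ArcAlg N) :
    hatDer N (x ⊗ₜ p) = oddDer N x ⊗ₜ p + x ⊗ₜ arcDer N p := by
  simp [hatDer]

theorem hatDer_mul (f g : HatAlg N) : hatDer N (f * g) = f * hatDer N g + hatDer N f * g := by
  induction f using TensorProduct.induction_on with
  | zero => simp
  | add f f' hf hf' => simp only [add_mul, map_add, hf, hf']; abel
  | tmul x p =>
    induction g using TensorProduct.induction_on with
    | zero => simp
    | add g g' hg hg' => simp only [mul_add, map_add, hg, hg']; abel
    | tmul y q =>
      simp only [Algebra.TensorProduct.tmul_mul_tmul, hatDer_tmul, oddDer_mul, Derivation.leibniz,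
        mul_add, add_mul, TensorProduct.add_tmul, TensorProduct.tmul_add, smul_eq_mul]
      rw [mul_comm q (arcDer N p)]
      abel

theorem pderiv_arcDer_zero (σ : Fin N) (p : ArcAlg N) :
    MvPolynomial.pderiv (σ, 0) (arcDer N p) = arcDer N (MvPolynomial.pderiv (σ, 0) p) := by
  induction p using MvPolynomial.induction_on with
  | C a => simp [arcDer]
  | add p q hp hq => simp [hp, hq]
  | mul_X p i hp =>
    simp only [Derivation.leibniz, map_add, smul_eq_mul, arcDer,
      MvPolynomial.mkDerivation_X, MvPolynomial.pderiv_X]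
    have h1 : (Pi.single (σ, 0) (1 : ArcAlg N) : (Fin N × ℕ) → ArcAlg N) (i.1, i.2 + 1) = 0 := by
      simp
    have h2 : MvPolynomial.mkDerivation ℂ (fun i : Fin N × ℕ => (MvPolynomial.X (i.1, i.2 + 1) :
        ArcAlg N)) ((Pi.single (σ, 0) (1 : ArcAlg N) : (Fin N × ℕ) → ArcAlg N) i) = 0 := by
      rw [Pi.single_apply]; split_ifs <;> simp
    simp only [arcDer] at hp
    rw [h1, h2, hp]
    ring

theorem pderiv_arcDer_succ (σ : Fin N) (n : ℕ) (p : ArcAlg N) :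
    MvPolynomial.pderiv (σ, n + 1) (arcDer N p) =
      arcDer N (MvPolynomial.pderiv (σ, n + 1) p) + MvPolynomial.pderiv (σ, n) p := by
  induction p using MvPolynomial.induction_on with
  | C a => simp [arcDer]
  | add p q hp hq => simp only [map_add, hp, hq]; abel
  | mul_X p i hp =>
    simp only [Derivation.leibniz, map_add, smul_eq_mul, arcDer,
      MvPolynomial.mkDerivation_X, MvPolynomial.pderiv_X]
    have h1 : (Pi.single (σ, n + 1) (1 : ArcAlg N) : (Fin N × ℕ) → ArcAlg N) (i.1, i.2 + 1) =
        (Pi.single (σ, n) (1 : ArcAlg N) : (Fin N × ℕ) → ArcAlg N) i := by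
      simp [Pi.single_apply, Prod.ext_iff]
    have h2 : MvPolynomial.mkDerivation ℂ (fun i : Fin N × ℕ => (MvPolynomial.X (i.1, i.2 + 1) :
        ArcAlg N)) ((Pi.single (σ, n + 1) (1 : ArcAlg N) : (Fin N × ℕ) → ArcAlg N) i) = 0 := by
      rw [Pi.single_apply]; split_ifs <;> simp
    simp only [arcDer] at hp
    rw [h1, h2, hp]
    ring

theorem dOdd_ι_mul (i : Fin N × ℕ) (v : (Fin N × ℕ) →₀ ℂ) (x : OddAlg N) :
    dOdd i (ExteriorAlgebra.ι ℂ v * x) = v i • x - ExteriorAlgebra.ι ℂ v * dOdd i x :=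
  CliffordAlgebra.contractLeft_ι_mul (Q := 0) _ v x

theorem dOdd_algebraMap (i : Fin N × ℕ) (r : ℂ) : dOdd i (algebraMap ℂ (OddAlg N) r) = 0 :=
  CliffordAlgebra.contractLeft_algebraMap _ _ r

theorem odd_induction {P : OddAlg N → Prop} (algebraMap : ∀ r : ℂ, P (algebraMap ℂ _ r))
    (add : ∀ x y, P x → P y → P (x + y))
    (ι_mul : ∀ x v, P x → P (ExteriorAlgebra.ι ℂ v * x)) (x : OddAlg N) : P x :=
  CliffordAlgebra.left_induction (Q := 0) (P := P) algebraMap add ι_mul x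

theorem oddShift_zero (σ : Fin N) (v : (Fin N × ℕ) →₀ ℂ) : oddShift N v (σ, 0) = 0 := by
  simp only [oddShift, Finsupp.lmapDomain_apply]
  apply Finsupp.mapDomain_of_notMem_range
  simp

theorem oddShift_succ (σ : Fin N) (n : ℕ) (v : (Fin N × ℕ) →₀ ℂ) :
    oddShift N v (σ, n + 1) = v (σ, n) := by
  simp only [oddShift, Finsupp.lmapDomain_apply]
  exact Finsupp.mapDomain_apply (f := fun i : Fin N × ℕ => (i.1, i.2 + 1))
    (by rintro ⟨a, b⟩ ⟨c, d⟩ h; simpa using h) v (σ, n)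

theorem dOdd_oddDer_zero (σ : Fin N) (x : OddAlg N) :
    dOdd (σ, 0) (oddDer N x) = oddDer N (dOdd (σ, 0) x) := by
  induction x using odd_induction with
  | algebraMap r => simp [oddDer_algebraMap, dOdd_algebraMap]
  | add x y hx hy => simp [hx, hy]
  | ι_mul x v hx =>
    simp only [oddDer_mul, oddDer_ι, map_add, map_sub, dOdd_ι_mul, map_smul, hx, oddShift_zero,
      zero_smul]
    abel

theorem dOdd_oddDer_succ (σ : Fin N) (n : ℕ) (x : OddAlg N) :
    dOdd (σ, n + 1) (oddDer N x) = oddDer N (dOdd (σ, n + 1) x) + dOdd (σ, n) x := by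
  induction x using odd_induction with
  | algebraMap r => simp [oddDer_algebraMap, dOdd_algebraMap]
  | add x y hx hy => simp only [map_add, hx, hy]; abel
  | ι_mul x v hx =>
    simp only [oddDer_mul, oddDer_ι, map_add, map_sub, dOdd_ι_mul, map_smul, hx, oddShift_succ,
      mul_add]
    abel

theorem dU_tmul (i : Fin N × ℕ) (x : OddAlg N) (p : ArcAlg N) :
    dU i (x ⊗ₜ p) = x ⊗ₜ MvPolynomial.pderiv i p := by simp [dU]

theorem dTheta_tmul (i : Fin N × ℕ) (x : OddAlg N) (p : ArcAlg N) :
    dTheta i (x ⊗ₜ p) = dOdd i x ⊗ₜ p := by simp [dTheta]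

theorem dU_hatDer_zero (σ : Fin N) (f : HatAlg N) :
    dU (σ, 0) (hatDer N f) = hatDer N (dU (σ, 0) f) := by
  induction f using TensorProduct.induction_on with
  | zero => simp
  | add f g hf hg => simp [hf, hg]
  | tmul x p => simp [hatDer_tmul, dU_tmul, pderiv_arcDer_zero]

theorem dU_hatDer_succ (σ : Fin N) (n : ℕ) (f : HatAlg N) :
    dU (σ, n + 1) (hatDer N f) = hatDer N (dU (σ, n + 1) f) + dU (σ, n) f := by
  induction f using TensorProduct.induction_on with
  | zero => simp
  | add f g hf hg => simp only [map_add, hf, hg]; abel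
  | tmul x p =>
    simp only [hatDer_tmul, dU_tmul, map_add, pderiv_arcDer_succ, TensorProduct.tmul_add]
    abel

theorem dTheta_hatDer_zero (σ : Fin N) (f : HatAlg N) :
    dTheta (σ, 0) (hatDer N f) = hatDer N (dTheta (σ, 0) f) := by
  induction f using TensorProduct.induction_on with
  | zero => simp
  | add f g hf hg => simp [hf, hg]
  | tmul x p => simp [hatDer_tmul, dTheta_tmul, dOdd_oddDer_zero]

theorem dTheta_hatDer_succ (σ : Fin N) (n : ℕ) (f : HatAlg N) :
    dTheta (σ, n + 1) (hatDer N f) = hatDer N (dTheta (σ, n + 1) f) + dTheta (σ, n) f := by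
  induction f using TensorProduct.induction_on with
  | zero => simp
  | add f g hf hg => simp only [map_add, hf, hg]; abel
  | tmul x p =>
    simp only [hatDer_tmul, dTheta_tmul, map_add, dOdd_oddDer_succ, TensorProduct.add_tmul]
    abel

theorem parity_hatDer (f : HatAlg N) : parity N (hatDer N f) = hatDer N (parity N f) := by
  have key : ∀ x : OddAlg N, CliffordAlgebra.involute (oddDer N x) =
      oddDer N (CliffordAlgebra.involute x) := by
    intro x
    induction x using odd_induction with
    | algebraMap r => simp [oddDer_algebraMap]
    | add x y hx hy => simp [hx, hy]
    | ι_mul x v hx =>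
      have h : ∀ w : (Fin N × ℕ) →₀ ℂ, CliffordAlgebra.involute (ExteriorAlgebra.ι ℂ w) =
          -ExteriorAlgebra.ι ℂ w := fun w => CliffordAlgebra.involute_ι w
      simp [oddDer_mul, oddDer_ι, hx, h, add_comm]
  induction f using TensorProduct.induction_on with
  | zero => simp
  | add f g hf hg => simp [hf, hg]
  | tmul x p => simp [hatDer_tmul, parity, key]

/-! #### Symbols of derivatives -/

theorem arc_finite (σ : Fin N) (p : ArcAlg N) :
    (Function.support fun n : ℕ => MvPolynomial.pderiv (σ, n) p).Finite := by
  refine ((p.vars.image Prod.snd).finite_toSet).subset fun n hn => ?_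
  by_contra h
  refine hn (MvPolynomial.pderiv_eq_zero_of_notMem_vars fun hm => h ?_)
  simpa using ⟨σ, hm⟩

theorem dU_finite (σ : Fin N) (f : HatAlg N) :
    (Function.support fun n : ℕ => dU (σ, n) f).Finite := by
  induction f using TensorProduct.induction_on with
  | zero => simp
  | add f g hf hg =>
    refine (hf.union hg).subset fun n hn => ?_
    by_contra h
    simp only [Set.mem_union, Function.mem_support, not_or, not_not] at h
    exact hn (by simp [h.1, h.2])
  | tmul x p =>
    refine (arc_finite σ p).subset fun n hn h => hn ?_
    simp only at h
    simp [dU_tmul, h]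

theorem dOdd_finite (σ : Fin N) (x : OddAlg N) :
    (Function.support fun n : ℕ => dOdd (σ, n) x).Finite := by
  induction x using odd_induction with
  | algebraMap r => simp [dOdd_algebraMap]
  | add f g hf hg =>
    refine (hf.union hg).subset fun n hn => ?_
    by_contra h
    simp only [Set.mem_union, Function.mem_support, not_or, not_not] at h
    exact hn (by simp [h.1, h.2])
  | ι_mul x v hx =>
    refine (hx.union (v.support.image Prod.snd).finite_toSet).subset fun n hn => ?_
    by_contra h
    simp only [Set.mem_union, Function.mem_support, not_or, not_not] at h
    refine hn ?_
    have hv : v (σ, n) = 0 := by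
      by_contra hv
      exact h.2 (by simpa using ⟨σ, hv⟩)
    simp [dOdd_ι_mul, h.1, hv]

theorem dTheta_finite (σ : Fin N) (f : HatAlg N) :
    (Function.support fun n : ℕ => dTheta (σ, n) f).Finite := by
  induction f using TensorProduct.induction_on with
  | zero => simp
  | add f g hf hg =>
    refine (hf.union hg).subset fun n hn => ?_
    by_contra h
    simp only [Set.mem_union, Function.mem_support, not_or, not_not] at h
    exact hn (by simp [h.1, h.2])
  | tmul x p =>
    refine (dOdd_finite σ x).subset fun n hn h => hn ?_
    simp only at h
    simp [dTheta_tmul, h]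

/-- `∑ₙ λ ^ n ∂f/∂u^{σ,(n)}` for a function `f` on the arc space of `𝔸ᴺ`. -/
def arcGrad (σ : Fin N) : ArcAlg N →ₗ[ℂ] (ℕ →₀ ArcAlg N) where
  toFun f := Finsupp.ofSupportFinite (fun n => MvPolynomial.pderiv (σ, n) f) (arc_finite σ f)
  map_add' f g := by ext1 n; simp [Finsupp.ofSupportFinite_coe]
  map_smul' c f := by ext1 n; simp [Finsupp.ofSupportFinite_coe]

/-- `∑ₙ λ ^ n ∂f/∂u^{σ,(n)}`. -/
def gradU (σ : Fin N) : HatAlg N →ₗ[ℂ] (ℕ →₀ HatAlg N) where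
  toFun f := Finsupp.ofSupportFinite (fun n => dU (σ, n) f) (dU_finite σ f)
  map_add' f g := by ext1 n; simp [Finsupp.ofSupportFinite_coe]
  map_smul' c f := by ext1 n; simp [Finsupp.ofSupportFinite_coe]

/-- `∑ₙ λ ^ n ∂f/∂θ_σ^{(n)}`. -/
def gradTheta (σ : Fin N) : HatAlg N →ₗ[ℂ] (ℕ →₀ HatAlg N) where
  toFun f := Finsupp.ofSupportFinite (fun n => dTheta (σ, n) f) (dTheta_finite σ f)
  map_add' f g := by ext1 n; simp [Finsupp.ofSupportFinite_coe]
  map_smul' c f := by ext1 n; simp [Finsupp.ofSupportFinite_coe]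

theorem lam_zero {M : Type*} [AddCommGroup M] [Module ℂ M] (p : ℕ →₀ M) : lam p 0 = 0 := by
  simp only [lam, Finsupp.lmapDomain_apply]
  exact Finsupp.mapDomain_of_notMem_range _ _ (by simp)

theorem lam_succ {M : Type*} [AddCommGroup M] [Module ℂ M] (p : ℕ →₀ M) (n : ℕ) :
    lam p (n + 1) = p n := by
  simp only [lam, Finsupp.lmapDomain_apply]
  exact Finsupp.mapDomain_apply Nat.succ_injective p n

theorem gradU_hatDer (σ : Fin N) (f : HatAlg N) :
    gradU σ (hatDer N f) = lamAdd (hatDer N) (gradU σ f) := by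
  ext1 n
  cases n with
  | zero => simp [gradU, Finsupp.ofSupportFinite_coe, lamAdd, lam_zero, coeffwise, dU_hatDer_zero]
  | succ n =>
    simp [gradU, Finsupp.ofSupportFinite_coe, lamAdd, lam_succ, coeffwise, dU_hatDer_succ, add_comm]

theorem gradTheta_hatDer (σ : Fin N) (f : HatAlg N) :
    gradTheta σ (hatDer N f) = lamAdd (hatDer N) (gradTheta σ f) := by
  ext1 n
  cases n with
  | zero =>
    simp [gradTheta, Finsupp.ofSupportFinite_coe, lamAdd, lam_zero, coeffwise, dTheta_hatDer_zero]
  | succ n =>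
    simp [gradTheta, Finsupp.ofSupportFinite_coe, lamAdd, lam_succ, coeffwise, dTheta_hatDer_succ,
      add_comm]

end Jets

/-! ### Master formula -/

section Master

variable {S : Type*} [Ring S] [Algebra ℂ S]

/-- `(w, ∑ λ ^ n hₙ) ↦ ∑ₙ ((λ + ∂) ^ n w) hₙ`, for `w` and `∑ λ ^ n hₙ` in `S[λ]`. -/
def actOn (d : S →ₗ[ℂ] S) : (ℕ →₀ S) →ₗ[ℂ] (ℕ →₀ S) →ₗ[ℂ] (ℕ →₀ S) :=
  LinearMap.mk₂ ℂ
    (fun w q => q.sum fun n h => coeffwise (LinearMap.mulRight ℂ h) ((lamAdd d ^ n) w))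
    (by
      intro w w' q
      simp [Finsupp.sum, Finset.sum_add_distrib])
    (by
      intro c w q
      simp [Finsupp.sum, Finset.smul_sum])
    (by
      intro w q q'
      refine Finsupp.sum_add_index' ?_ ?_
      · intro n; ext k; simp [coeffwise]
      · intro n h h'; ext k; simp [coeffwise, mul_add])
    (by
      intro c w q
      rw [Finsupp.sum_smul_index' (by intro n; ext k; simp [coeffwise]), Finsupp.smul_sum]
      refine Finsupp.sum_congr fun n _ => ?_
      ext k
      simp [coeffwise])

theorem lam_single {M : Type*} [AddCommGroup M] [Module ℂ M] (n : ℕ) (m : M) :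
    lam (Finsupp.single n m) = Finsupp.single (n + 1) m := by
  simp [lam]

theorem lam_coeffwise {M M' : Type*} [AddCommGroup M] [Module ℂ M] [AddCommGroup M'] [Module ℂ M']
    (f : M →ₗ[ℂ] M') (p : ℕ →₀ M) : lam (coeffwise f p) = coeffwise f (lam p) := by
  induction p using Finsupp.induction_linear with
  | zero => simp
  | add p q hp hq => simp [hp, hq]
  | single n m => simp [lam_single, coeffwise]

theorem lam_lamAdd {M : Type*} [AddCommGroup M] [Module ℂ M] (d : M →ₗ[ℂ] M) (p : ℕ →₀ M) :
    lam (lamAdd d p) = lamAdd d (lam p) := by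
  simp [lamAdd, lam_coeffwise]

theorem coeffwise_lamAdd {M : Type*} [AddCommGroup M] [Module ℂ M] (d : M →ₗ[ℂ] M) (p : ℕ →₀ M) :
    coeffwise d (lamAdd d p) = lamAdd d (coeffwise d p) := by
  simp [lamAdd, lam_coeffwise]

theorem negLamSub_lamAdd {M : Type*} [AddCommGroup M] [Module ℂ M] (d : M →ₗ[ℂ] M) (p : ℕ →₀ M) :
    negLamSub d (lamAdd d p) = -lam (negLamSub d p) := by
  induction p using Finsupp.induction_linear with
  | zero => simp
  | add p q hp hq => simp only [map_add, hp, hq, neg_add]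
  | single n m =>
    have hc : Commute (coeffwise d) (-lamAdd d) := by
      have : Commute (coeffwise d) (lamAdd d) := LinearMap.ext fun p => coeffwise_lamAdd d p
      exact Commute.neg_right (R := Module.End ℂ (ℕ →₀ M)) this
    have h := DFunLike.congr_fun (hc.pow_right n).eq (Finsupp.single 0 m)
    simp only [Module.End.mul_apply] at h
    have h0 : (Finsupp.single 0 (d m) : ℕ →₀ M) = coeffwise d (Finsupp.single 0 m) := by
      simp [coeffwise]
    have e : lamAdd d (Finsupp.single n m) = Finsupp.single (n + 1) m + Finsupp.single n (d m) := by
      simp [lamAdd, lam_single, coeffwise]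
    have hs : ∀ (k : ℕ) (x : M), negLamSub d (Finsupp.single k x) =
        ((-lamAdd d) ^ k) (Finsupp.single 0 x) := by
      intro k x; simp [negLamSub, subst]
    rw [e, map_add, hs, hs, hs, h0, ← h, pow_succ']
    simp only [Module.End.mul_apply, LinearMap.neg_apply, lamAdd, LinearMap.add_apply]
    abel

theorem actOn_single (d : S →ₗ[ℂ] S) (w : ℕ →₀ S) (n : ℕ) (h : S) :
    actOn d w (Finsupp.single n h) = coeffwise (LinearMap.mulRight ℂ h) ((lamAdd d ^ n) w) := by
  simp only [actOn, LinearMap.mk₂_apply]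
  refine Finsupp.sum_single_index ?_
  ext k
  simp [coeffwise]

theorem actOn_lam (d : S →ₗ[ℂ] S) (w q : ℕ →₀ S) : actOn d (lam w) q = lam (actOn d w q) := by
  have hc : Commute (lam (M := S)) (lamAdd d) :=
    LinearMap.ext fun p => lam_lamAdd d p
  induction q using Finsupp.induction_linear with
  | zero => simp
  | add p q hp hq => simp only [map_add, hp, hq]
  | single n h =>
    have h := DFunLike.congr_fun (hc.pow_right n).eq w
    simp only [Module.End.mul_apply] at h
    rw [actOn_single, actOn_single, lam_coeffwise, h]

theorem actOn_neg_lam (d : S →ₗ[ℂ] S) (w q : ℕ →₀ S) :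
    actOn d (-lam w) q = -lam (actOn d w q) := by
  rw [map_neg, LinearMap.neg_apply, actOn_lam]

theorem actOn_lamAdd (d : S →ₗ[ℂ] S) (hd : ∀ a b, d (a * b) = a * d b + d a * b)
    (w q : ℕ →₀ S) : actOn d w (lamAdd d q) = lamAdd d (actOn d w q) := by
  have key : ∀ (v : ℕ →₀ S) (h : S), lamAdd d (coeffwise (LinearMap.mulRight ℂ h) v) =
      coeffwise (LinearMap.mulRight ℂ h) (lamAdd d v) +
        coeffwise (LinearMap.mulRight ℂ (d h)) v := by
    intro v h
    simp only [lamAdd, LinearMap.add_apply, lam_coeffwise, map_add, add_assoc]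
    congr 1
    ext k
    simp [coeffwise, hd, add_comm]
  induction q using Finsupp.induction_linear with
  | zero => simp
  | add p q hp hq => simp only [map_add, hp, hq]
  | single n h =>
    have e : lamAdd d (Finsupp.single n h) = Finsupp.single (n + 1) h + Finsupp.single n (d h) := by
      simp [lamAdd, lam_single, coeffwise]
    rw [e, map_add, actOn_single, actOn_single, actOn_single, key, pow_succ', Module.End.mul_apply]

end Master

/-! ### The Poisson vertex algebra structure on `S(L) = O((𝔸ᴺ)_∞)` -/

section PVA

variable {L : Type*} [AddCommGroup L] [Module ℂ L] [Module ℂ[X] L] [IsScalarTower ℂ ℂ[X] L]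
  {N : ℕ}

/-- The embedding of `L` in the functions on the arc space of `𝔸ᴺ` given by a `ℂ[∂]`-basis `b`:
`∂ ^ n b_α ↦ u^{α,(n)}`. -/
def jetEmb (b : Module.Basis (Fin N) ℂ[X] L) : L →ₗ[ℂ] ArcAlg N :=
  ∑ α, (Polynomial.basisMonomials ℂ).constr ℂ (fun n => (MvPolynomial.X (α, n) : ArcAlg N)) ∘ₗ
    (b.coord α).restrictScalars ℂ

/-- The extension of the `λ`-bracket `B` of `L` to functions on the arc space by the Master Formula
`{f_λ g} = ∑ ∂g/∂u^{β,(n)} (λ+∂)^n {u^α_{λ+∂} u^β}_→ (-λ-∂)^m ∂f/∂u^{α,(m)}`. -/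
def pvaBracket (B : L →ₗ[ℂ] L →ₗ[ℂ] (ℕ →₀ L)) (b : Module.Basis (Fin N) ℂ[X] L)
    (f g : ArcAlg N) : ℕ →₀ ArcAlg N :=
  ∑ α, ∑ β,
    actOn (arcDer N).toLinearMap
      (actOn (arcDer N).toLinearMap
        (negLamSub (arcDer N).toLinearMap (arcGrad α f))
        (coeffwise (jetEmb b) (B (b α) (b β))))
      (arcGrad β g)

/-- The coordinate function `θ_α^{(n)}`. -/
def theta (i : Fin N × ℕ) : HatAlg N := oddVar i ⊗ₜ 1

/-- Functions on the arc space of `𝔸ᴺ` as functions of odd degree `0`. -/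
def ofArc (N : ℕ) : ArcAlg N →ₐ[ℂ] HatAlg N := Algebra.TensorProduct.includeRight

/-- `P = ∑ θ_α {u^β_∂ u^α}_→ θ_β`, where `{u^β_λ u^α} = ∑ λ ^ s cₛ` becomes the operator
`∑ cₛ ∂ ^ s` acting on `θ_β`. -/
def bivector (B : L →ₗ[ℂ] L →ₗ[ℂ] (ℕ →₀ L)) (b : Module.Basis (Fin N) ℂ[X] L) : HatAlg N :=
  ∑ α, ∑ β, theta (α, 0) *
    (pvaBracket B b (MvPolynomial.X (β, 0)) (MvPolynomial.X (α, 0))).sum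
      fun s c => ofArc N c * theta (β, s)

end PVA

/-! ### Local functionals -/

section Functionals

variable {N : ℕ}

/-- `{f_λ u^σ} = (-1)^{|f|} {u^σ_{-λ-∂} f}`. -/
def bracketWithU (σ : Fin N) : HatAlg N →ₗ[ℂ] (ℕ →₀ HatAlg N) :=
  negLamSub (hatDer N) ∘ₗ gradTheta σ ∘ₗ parity N

/-- `{f_λ θ_σ} = -{θ_σ_{-λ-∂} f}`. -/
def bracketWithTheta (σ : Fin N) : HatAlg N →ₗ[ℂ] (ℕ →₀ HatAlg N) :=
  negLamSub (hatDer N) ∘ₗ gradU σ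

/-- The `λ`-bracket `{f_λ g}` of degree `-1` on functions on the arc space of `T*[1]𝔸ᴺ`: the
sesquilinear extension of `{u^α_λ θ_β} = δ^α_β`, `{u^α_λ u^β} = {θ_α_λ θ_β} = 0` with
`{f_λ gh} = {f_λ g}h + (-1)^{(|f|+1)|g|} g{f_λ h}` and
`{f_λ g} = -(-1)^{(|f|+1)(|g|+1)} {g_{-λ-∂} f}`, that is
`{f_λ g} = ∑ ((λ+∂)^n {f_λ u^σ}) ∂g/∂u^{σ,(n)} + ∑ ((λ+∂)^n {f_λ θ_σ}) ∂g/∂θ_σ^{(n)}`. -/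
def chiralBracket (N : ℕ) : HatAlg N →ₗ[ℂ] HatAlg N →ₗ[ℂ] (ℕ →₀ HatAlg N) :=
  ∑ σ, ((actOn (hatDer N)).compl₁₂ (bracketWithU σ) (gradU σ) +
    (actOn (hatDer N)).compl₁₂ (bracketWithTheta σ) (gradTheta σ))

theorem chiralBracket_apply (f g : HatAlg N) : chiralBracket N f g =
    ∑ σ, (actOn (hatDer N) (bracketWithU σ f) (gradU σ g) +
      actOn (hatDer N) (bracketWithTheta σ f) (gradTheta σ g)) := by
  simp [chiralBracket, LinearMap.sum_apply]

theorem chiralBracket_der_left (f g : HatAlg N) :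
    chiralBracket N (hatDer N f) g = -lam (chiralBracket N f g) := by
  simp only [chiralBracket_apply, bracketWithU, bracketWithTheta, LinearMap.comp_apply,
    parity_hatDer, gradU_hatDer, gradTheta_hatDer, negLamSub_lamAdd, map_sum, map_add]
  rw [← Finset.sum_neg_distrib]
  refine Finset.sum_congr rfl fun σ _ => ?_
  rw [neg_add, actOn_neg_lam, actOn_neg_lam]

theorem chiralBracket_der_right (f g : HatAlg N) :
    chiralBracket N f (hatDer N g) = lamAdd (hatDer N) (chiralBracket N f g) := by
  simp [chiralBracket_apply, gradU_hatDer, gradTheta_hatDer, actOn_lamAdd _ hatDer_mul]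

/-- The space of local functionals: functions modulo total derivatives. -/
abbrev LocalFunctional (N : ℕ) : Type := HatAlg N ⧸ LinearMap.range (hatDer N)

/-- The quotient map `f ↦ ∫ f`. -/
def integral (N : ℕ) : HatAlg N →ₗ[ℂ] LocalFunctional N := (LinearMap.range (hatDer N)).mkQ

/-- Local functionals of degree `p`. -/
def functionalDeg (N p : ℕ) : Submodule ℂ (LocalFunctional N) := (hatDeg N p).map (integral N)

/-- The bracket of local functionals, `[∫ f, ∫ g] = ∫ {f_λ g}|_{λ = 0}`. -/
def functionalBracket (N : ℕ) :
    LocalFunctional N →ₗ[ℂ] LocalFunctional N →ₗ[ℂ] LocalFunctional N :=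
  (LinearMap.range (hatDer N)).liftQ
    (((LinearMap.range (hatDer N)).liftQ
      (((chiralBracket N).compr₂ (integral N ∘ₗ Finsupp.lapply 0)).flip)
      (by
        rintro _ ⟨g, rfl⟩
        rw [LinearMap.mem_ker]
        refine LinearMap.ext fun f => ?_
        simp only [LinearMap.flip_apply, LinearMap.compr₂_apply, LinearMap.comp_apply,
          Finsupp.lapply_apply, chiralBracket_der_right, LinearMap.zero_apply]
        refine (Submodule.Quotient.mk_eq_zero _).2 ⟨chiralBracket N f g 0, ?_⟩
        simp [lamAdd, lam_zero, coeffwise])).flip)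
    (by
      rintro _ ⟨f, rfl⟩
      rw [LinearMap.mem_ker]
      refine LinearMap.ext fun x => ?_
      obtain ⟨g, rfl⟩ := Submodule.Quotient.mk_surjective _ x
      change integral N (chiralBracket N (hatDer N f) g 0) = 0
      simp [chiralBracket_der_left, lam_zero])

theorem functionalBracket_integral (f g : HatAlg N) :
    functionalBracket N (integral N f) (integral N g) = integral N (chiralBracket N f g 0) := rfl

/-- `Θ` is a Maurer–Cartan element of the dg Lie algebra of local functionals with bracket
`[·,·]` and differential `d_P = [P, ·]`. The Lie degree is one less than the degree in the odd
coordinates, so that Maurer–Cartan elements have degree `2`. -/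
def IsMaurerCartan (P Θ : LocalFunctional N) : Prop :=
  Θ ∈ functionalDeg N 2 ∧
    functionalBracket N P Θ + (1 / 2 : ℂ) • functionalBracket N Θ Θ = 0

end Functionals

end ConformalR

end

noncomputable section

/-!
Let `P` be the bivector of a skew and sesquilinear `λ`-bracket on `L`. As `P` is central and
quadratic in the `θ_α`, the bracket `[∫ P, ∫ P]` is `-4 ∫ T`, where the cubic function `T` is built
from the iterated brackets of the basis. By Euler's identity `3 T = ∑ θ_ρ^{(n)} ∂T/∂θ_ρ^{(n)}`,
which equals `∑ θ_ρ δT/δθ_ρ` modulo total derivatives, `∫ T = 0` if and only if all the variational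
derivatives `δT/δθ_ρ` vanish. These are the Jacobiators `J(u^γ, u^β, u^ρ)`, applied to `θ_γ` and
`θ_β` and summed over `γ` and `β`; since `J` is skew in its first two arguments, it is recovered
from the sum. Sesquilinearity reduces the Jacobi identity to the basis, so `[∫ P, ∫ P] = 0` if and
only if the bracket is a Lie conformal algebra. The Maurer–Cartan equation is the vanishing of
`[∫ P_R, ∫ P_R]`, because `[∫ P + Θ, ∫ P + Θ] = 2 (d_P Θ + [Θ, Θ] / 2)` once `[∫ P, ∫ P] = 0`.

The Jacobiator of `[·_λ ·]_R` is the Jacobiator of the given bracket polarized at pairs of `R`'s, up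
to brackets with the Yang–Baxter defect `[R(a)_λ R(b)] - R([a_λ b]_R)`. If this defect is
`-κ [a_λ b]`, the correction is itself a multiple of a Jacobiator.
-/

namespace ConformalR

/-! ### Substitution for the formal variable -/

section Substitution

variable {M M' W W' : Type*} [AddCommGroup M] [Module ℂ M] [AddCommGroup M'] [Module ℂ M']
  [AddCommGroup W] [Module ℂ W] [AddCommGroup W'] [Module ℂ W']

theorem coeffwise_apply (f : M →ₗ[ℂ] M') (p : ℕ →₀ M) (n : ℕ) : coeffwise f p n = f (p n) := by
  simp [coeffwise]

theorem coeffwise_single (f : M →ₗ[ℂ] M') (n : ℕ) (m : M) :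
    coeffwise f (Finsupp.single n m) = Finsupp.single n (f m) := by
  simp [coeffwise]

theorem coeffwise_comm_of_comm {f : M →ₗ[ℂ] M'} {g : M →ₗ[ℂ] M} {g' : M' →ₗ[ℂ] M'}
    (h : ∀ x, f (g x) = g' (f x)) (p : ℕ →₀ M) :
    coeffwise f (coeffwise g p) = coeffwise g' (coeffwise f p) := by
  ext n
  simp [coeffwise_apply, h]

theorem coeffwise_lamAdd_of_comm {f : M →ₗ[ℂ] M'} {d : M →ₗ[ℂ] M} {d' : M' →ₗ[ℂ] M'}
    (h : ∀ x, f (d x) = d' (f x)) (p : ℕ →₀ M) :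
    coeffwise f (lamAdd d p) = lamAdd d' (coeffwise f p) := by
  simp only [lamAdd, LinearMap.add_apply, map_add, lam_coeffwise, coeffwise_comm_of_comm h]

theorem lamAdd_single (d : M →ₗ[ℂ] M) (n : ℕ) (m : M) :
    lamAdd d (Finsupp.single n m) = Finsupp.single (n + 1) m + Finsupp.single n (d m) := by
  simp [lamAdd, lam_single, coeffwise_single]

theorem lamAdd_lamAdd (d : M →ₗ[ℂ] M) (p : ℕ →₀ ℕ →₀ M) :
    lamAdd (lamAdd d) p = lamAdd lam p + coeffwise (coeffwise d) p := by
  ext m n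
  simp [lamAdd, coeffwise_apply, add_assoc]

theorem lamAdd_apply_zero (d : M →ₗ[ℂ] M) (p : ℕ →₀ M) : lamAdd d p 0 = d (p 0) := by
  simp [lamAdd, lam_zero, coeffwise_apply]

theorem subst_single (T : W →ₗ[ℂ] W) (j : M →ₗ[ℂ] W) (n : ℕ) (m : M) :
    subst T j (Finsupp.single n m) = (T ^ n) (j m) := by
  simp [subst]

theorem subst_add (T : W →ₗ[ℂ] W) (j j' : M →ₗ[ℂ] W) :
    subst T (j + j') = subst T j + subst T j' := by
  ext : 2
  simp [subst_single]

theorem subst_smul (T : W →ₗ[ℂ] W) (c : ℂ) (j : M →ₗ[ℂ] W) :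
    subst T (c • j) = c • subst T j := by
  ext : 2
  simp [subst_single]

theorem subst_lam (T : W →ₗ[ℂ] W) (j : M →ₗ[ℂ] W) (p : ℕ →₀ M) :
    subst T j (lam p) = T (subst T j p) := by
  induction p using Finsupp.induction_linear with
  | zero => simp
  | add p q hp hq => simp only [map_add, hp, hq]
  | single n m => simp [lam_single, subst_single, pow_succ']

theorem subst_coeffwise (T : W →ₗ[ℂ] W) (j : M' →ₗ[ℂ] W) (g : M →ₗ[ℂ] M') (p : ℕ →₀ M) :
    subst T j (coeffwise g p) = subst T (j ∘ₗ g) p := by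
  induction p using Finsupp.induction_linear with
  | zero => simp
  | add p q hp hq => simp only [map_add, hp, hq]
  | single n m => simp [coeffwise_single, subst_single]

theorem map_pow_of_comm {g : W →ₗ[ℂ] W'} {T : W →ₗ[ℂ] W} {T' : W' →ₗ[ℂ] W'}
    (h : ∀ x, g (T x) = T' (g x)) (n : ℕ) (x : W) : g ((T ^ n) x) = (T' ^ n) (g x) := by
  have hpow : (T' ^ n) ∘ₗ g = g ∘ₗ (T ^ n) :=
    Module.End.commute_pow_left_of_commute (LinearMap.ext fun x => (h x).symm) n
  exact (DFunLike.congr_fun hpow x).symm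

theorem map_subst {g : W →ₗ[ℂ] W'} {T : W →ₗ[ℂ] W} {T' : W' →ₗ[ℂ] W'}
    (h : ∀ x, g (T x) = T' (g x)) (j : M →ₗ[ℂ] W) (p : ℕ →₀ M) :
    g (subst T j p) = subst T' (g ∘ₗ j) p := by
  induction p using Finsupp.induction_linear with
  | zero => simp
  | add p q hp hq => simp only [map_add, hp, hq]
  | single n m => simp [subst_single, map_pow_of_comm h]

theorem subst_lam_lsingle_zero (p : ℕ →₀ M) : subst lam (Finsupp.lsingle 0) p = p := by
  have hpow (n : ℕ) (m : M) : (lam ^ n) (Finsupp.single 0 m) = Finsupp.single n m := by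
    induction n with
    | zero => simp
    | succ n ih => rw [pow_succ', Module.End.mul_apply, ih, lam_single]
  induction p using Finsupp.induction_linear with
  | zero => simp
  | add p q hp hq => simp only [map_add, hp, hq]
  | single n m => simp [subst_single, hpow]

theorem eq_subst_of_map_lam {f : (ℕ →₀ M) →ₗ[ℂ] W} {T : W →ₗ[ℂ] W}
    (h : ∀ p, f (lam p) = T (f p)) (p : ℕ →₀ M) : f p = subst T (f ∘ₗ Finsupp.lsingle 0) p := by
  rw [← map_subst h, subst_lam_lsingle_zero]

theorem subst_lamAdd_of_comm {T D : W →ₗ[ℂ] W} {d : M →ₗ[ℂ] M} {j : M →ₗ[ℂ] W}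
    (hT : ∀ x, D (T x) = T (D x)) (hj : ∀ m, j (d m) = D (j m)) (p : ℕ →₀ M) :
    subst T j (lamAdd d p) = T (subst T j p) + D (subst T j p) := by
  have hjd : j ∘ₗ d = D ∘ₗ j := LinearMap.ext hj
  rw [map_subst hT, ← hjd, ← subst_coeffwise, ← subst_lam, ← map_add]
  rfl

end Substitution

section SwapVar

variable {M : Type*} [AddCommGroup M] [Module ℂ M]

variable (M) in
/-- The exchange of the two variables of `M[λ][μ]`. -/
def swapVar : (ℕ →₀ ℕ →₀ M) ≃ₗ[ℂ] (ℕ →₀ ℕ →₀ M) :=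
  (Finsupp.curryLinearEquiv ℂ).symm ≪≫ₗ Finsupp.domLCongr (Equiv.prodComm ℕ ℕ) ≪≫ₗ
    Finsupp.curryLinearEquiv ℂ

theorem swapVar_single (m n : ℕ) (x : M) :
    swapVar M (Finsupp.single m (Finsupp.single n x)) = Finsupp.single n (Finsupp.single m x) := by
  simp [swapVar]

theorem swapVar_apply (p : ℕ →₀ ℕ →₀ M) (m n : ℕ) : swapVar M p m n = p n m := rfl

theorem swapVar_swapVar (p : ℕ →₀ ℕ →₀ M) : swapVar M (swapVar M p) = p := by
  ext m n
  simp [swapVar_apply]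

theorem swapVar_lam (p : ℕ →₀ ℕ →₀ M) : swapVar M (lam p) = coeffwise lam (swapVar M p) := by
  ext m n
  cases n <;> simp [swapVar_apply, coeffwise_apply, lam_zero, lam_succ]

theorem swapVar_coeffwise_lam (p : ℕ →₀ ℕ →₀ M) :
    swapVar M (coeffwise lam p) = lam (swapVar M p) := by
  rw [← swapVar_swapVar (lam _), swapVar_lam, swapVar_swapVar]

theorem swapVar_lamAdd_lam (p : ℕ →₀ ℕ →₀ M) :
    swapVar M (lamAdd lam p) = lamAdd lam (swapVar M p) := by
  simp [lamAdd, swapVar_lam, swapVar_coeffwise_lam, add_comm]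

theorem swapVar_lamAdd_lamAdd (d : M →ₗ[ℂ] M) (p : ℕ →₀ ℕ →₀ M) :
    swapVar M (lamAdd (lamAdd d) p) = lamAdd (lamAdd d) (swapVar M p) := by
  ext m n
  cases m <;> cases n <;>
    simp [swapVar_apply, coeffwise_apply, lamAdd, lam_zero, lam_succ, add_left_comm]

theorem swapVar_eq_subst (p : ℕ →₀ ℕ →₀ M) :
    swapVar M p = subst (coeffwise (lam (M := M))) (coeffwise (Finsupp.lsingle 0)) p := by
  have hzero : (swapVar M).toLinearMap ∘ₗ Finsupp.lsingle 0 = coeffwise (Finsupp.lsingle 0) := by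
    ext : 2
    simp [swapVar_single, coeffwise_single]
  rw [← hzero]
  exact eq_subst_of_map_lam (f := (swapVar M).toLinearMap) swapVar_lam p

end SwapVar

/-! ### The Jacobiator -/

section Jacobiator

variable {L : Type*} [AddCommGroup L] [Module ℂ L]

/-- The term `[a_λ [b_μ c]]` of the Jacobi identity, as a function of `a` and `q = [b_μ c]`. -/
def jacobiLeft (B : L →ₗ[ℂ] L →ₗ[ℂ] (ℕ →₀ L)) : L →ₗ[ℂ] (ℕ →₀ L) →ₗ[ℂ] (ℕ →₀ ℕ →₀ L) :=
  LinearMap.mk₂ ℂ (fun a q => coeffwise (B a) q)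
    (by intros; ext; simp [coeffwise_apply]) (by intros; ext; simp [coeffwise_apply])
    (by simp) (by simp)

/-- The bracket `[x_{λ+μ} c]`, as a function of `c` and `x`. -/
def bracketSum (B : L →ₗ[ℂ] L →ₗ[ℂ] (ℕ →₀ L)) : L →ₗ[ℂ] L →ₗ[ℂ] (ℕ →₀ ℕ →₀ L) :=
  B.flip.compr₂ (subst (lamAdd lam) (Finsupp.lsingle 0 ∘ₗ Finsupp.lsingle 0))

/-- The term `[[a_λ b]_{λ+μ} c]` of the Jacobi identity, as a function of `c` and
`q = [a_λ b]`. -/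
def jacobiMid (B : L →ₗ[ℂ] L →ₗ[ℂ] (ℕ →₀ L)) : L →ₗ[ℂ] (ℕ →₀ L) →ₗ[ℂ] (ℕ →₀ ℕ →₀ L) :=
  LinearMap.mk₂ ℂ (fun c q => subst (coeffwise lam) (bracketSum B c) q)
    (by intros; simp [subst_add]) (by intros; simp [subst_smul]) (by simp) (by simp)

/-- The difference of the two sides of the Jacobi identity; its last term is
`[b_μ [a_λ c]]`, obtained from `[b_λ [a_μ c]]` by exchanging `λ` and `μ`. -/
def jacobiator (B : L →ₗ[ℂ] L →ₗ[ℂ] (ℕ →₀ L)) :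
    L →ₗ[ℂ] L →ₗ[ℂ] L →ₗ[ℂ] (ℕ →₀ ℕ →₀ L) :=
  LinearMap.mk₂ ℂ
    (fun a b => jacobiLeft B a ∘ₗ B b - (jacobiMid B).flip (B a b) -
      (swapVar L).toLinearMap ∘ₗ jacobiLeft B b ∘ₗ B a)
    (by intros; ext1; simp; abel) (by intros; ext1; simp [smul_sub])
    (by intros; ext1; simp; abel) (by intros; ext1; simp [smul_sub])

variable (B : L →ₗ[ℂ] L →ₗ[ℂ] (ℕ →₀ L))

theorem jacobiLeft_apply (a : L) (q : ℕ →₀ L) : jacobiLeft B a q = coeffwise (B a) q := rfl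

theorem bracketSum_apply (c x : L) : bracketSum B c x =
    subst (lamAdd lam) (Finsupp.lsingle 0 ∘ₗ Finsupp.lsingle 0) (B x c) := rfl

theorem jacobiMid_apply (c : L) (q : ℕ →₀ L) :
    jacobiMid B c q = subst (coeffwise lam) (bracketSum B c) q := rfl

theorem jacobiator_apply (a b c : L) : jacobiator B a b c =
    jacobiLeft B a (B b c) - jacobiMid B c (B a b) - swapVar L (jacobiLeft B b (B a c)) := rfl

theorem swapVar_bracketSum (c x : L) : swapVar L (bracketSum B c x) = bracketSum B c x := by
  have hsingle : (swapVar L).toLinearMap ∘ₗ Finsupp.lsingle 0 ∘ₗ Finsupp.lsingle 0 =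
      (Finsupp.lsingle 0 ∘ₗ Finsupp.lsingle 0 : L →ₗ[ℂ] ℕ →₀ ℕ →₀ L) := by
    ext : 1
    simp [swapVar_single]
  simpa [bracketSum_apply, hsingle] using
    map_subst (g := (swapVar L).toLinearMap) swapVar_lamAdd_lam
      (Finsupp.lsingle 0 ∘ₗ Finsupp.lsingle 0) (B x c)

end Jacobiator

/-! ### The Yang–Baxter equation -/

section YangBaxter

variable {L : Type*} [AddCommGroup L] [Module ℂ L]
  (B : L →ₗ[ℂ] L →ₗ[ℂ] (ℕ →₀ L)) (R : L →ₗ[ℂ] L)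

/-- The defect `[R a_λ R b] - R([a_λ b]_R)` of the classical Yang–Baxter equation. -/
def yangBaxterDefect (a b : L) : ℕ →₀ L :=
  B (R a) (R b) - coeffwise R (bracketR B R a b)

theorem bracketR_apply (a b : L) : bracketR B R a b = B (R a) b + B a (R b) := rfl

theorem jacobiLeft_bracketR (a : L) (q : ℕ →₀ L) :
    jacobiLeft (bracketR B R) a q = jacobiLeft B (R a) q + jacobiLeft B a (coeffwise R q) := by
  ext n
  simp [jacobiLeft_apply, coeffwise_apply, bracketR_apply]

theorem bracketSum_bracketR (c : L) :
    bracketSum (bracketR B R) c = bracketSum B (R c) + bracketSum B c ∘ₗ R := by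
  ext1 x
  simp [bracketSum_apply, bracketR_apply, add_comm]

theorem jacobiMid_bracketR (c : L) (q : ℕ →₀ L) :
    jacobiMid (bracketR B R) c q = jacobiMid B (R c) q + jacobiMid B c (coeffwise R q) := by
  simp only [jacobiMid_apply, bracketSum_bracketR, subst_add, subst_coeffwise, LinearMap.add_apply]

theorem jacobiator_bracketR (a b c : L) :
    jacobiator (bracketR B R) a b c =
      jacobiator B (R a) (R b) c + jacobiator B (R a) b (R c) + jacobiator B a (R b) (R c) -
        (jacobiLeft B a (yangBaxterDefect B R b c) - jacobiMid B c (yangBaxterDefect B R a b) -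
          swapVar L (jacobiLeft B b (yangBaxterDefect B R a c))) := by
  simp only [jacobiator_apply, jacobiLeft_bracketR, jacobiMid_bracketR, yangBaxterDefect, map_sub,
    map_add]
  simp only [bracketR_apply, map_add]
  abel

theorem ModifiedCYBE.jacobiator_bracketR {B : L →ₗ[ℂ] L →ₗ[ℂ] (ℕ →₀ L)} {R : L →ₗ[ℂ] L} {κ : ℂ}
    (h : ModifiedCYBE κ B R) (a b c : L) :
    jacobiator (bracketR B R) a b c =
      jacobiator B (R a) (R b) c + jacobiator B (R a) b (R c) + jacobiator B a (R b) (R c) +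
        κ • jacobiator B a b c := by
  have hY (x y : L) : yangBaxterDefect B R x y = -(κ • B x y) := h x y
  rw [ConformalR.jacobiator_bracketR, hY, hY, hY, jacobiator_apply B a b c]
  simp only [map_neg, map_smul, smul_sub]
  abel

end YangBaxter

/-! ### Skew-symmetric sesquilinear brackets -/

section FreeModule

variable {L : Type*} [AddCommGroup L] [Module ℂ L] [Module ℂ[X] L] [IsScalarTower ℂ ℂ[X] L]
  {ι : Type*}

/-- The `ℂ`-basis `∂ ^ n b_α` of a free `ℂ[∂]`-module. -/
def jetBasis (b : Module.Basis ι ℂ[X] L) : Module.Basis (ι × ℕ) ℂ L :=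
  (Polynomial.basisMonomials ℂ).smulTower' b

theorem jetBasis_apply (b : Module.Basis ι ℂ[X] L) (i : ι × ℕ) :
    jetBasis b i = (Polynomial.X ^ i.2 : ℂ[X]) • b i.1 := by
  simp [jetBasis, Module.Basis.smulTower'_apply, Polynomial.X_pow_eq_monomial]

theorem jetBasis_zero (b : Module.Basis ι ℂ[X] L) (α : ι) : jetBasis b (α, 0) = b α := by
  simp [jetBasis_apply]

theorem transl_jetBasis (b : Module.Basis ι ℂ[X] L) (α : ι) (n : ℕ) :
    transl L (jetBasis b (α, n)) = jetBasis b (α, n + 1) := by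
  simp [jetBasis_apply, transl, smul_smul, pow_succ, mul_comm]

theorem ext_of_transl {W : Type*} [AddCommGroup W] [Module ℂ W]
    (b : Module.Basis ι ℂ[X] L) {f g : L →ₗ[ℂ] W} (T : W → W)
    (hf : ∀ a, f (transl L a) = T (f a)) (hg : ∀ a, g (transl L a) = T (g a))
    (h : ∀ α, f (b α) = g (b α)) : f = g := by
  refine (jetBasis b).ext ?_
  rintro ⟨α, n⟩
  induction n with
  | zero => simpa [jetBasis_zero] using h α
  | succ n ih => rw [← transl_jetBasis, hf, hg, ih]

end FreeModule

section SkewSesquilinear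

variable {L : Type*} [AddCommGroup L] [Module ℂ L] [Module ℂ[X] L] [IsScalarTower ℂ ℂ[X] L]

/-- A `λ`-bracket with `[∂a_λ b] = -λ[a_λ b]` and `[a_λ ∂b] = (λ + ∂)[a_λ b]`. -/
structure IsSesquilinear (B : L →ₗ[ℂ] L →ₗ[ℂ] (ℕ →₀ L)) : Prop where
  sesq_left : ∀ a b, B (transl L a) b = -lam (B a b)
  sesq_right : ∀ a b, B a (transl L b) = lamAdd (transl L) (B a b)

/-- The axioms of a Lie conformal algebra other than the Jacobi identity. -/
structure IsSkewSesquilinear (B : L →ₗ[ℂ] L →ₗ[ℂ] (ℕ →₀ L)) : Prop extends IsSesquilinear B where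
  skew : ∀ a b, B b a = -negLamSub (transl L) (B a b)

variable {B : L →ₗ[ℂ] L →ₗ[ℂ] (ℕ →₀ L)}

theorem isLieConformal_iff_jacobiator_eq_zero :
    IsLieConformal B ↔ IsSkewSesquilinear B ∧ ∀ a b c, jacobiator B a b c = 0 := by
  have hjacobi (a b c : L) : jacobiator B a b c = 0 ↔
      coeffwise (B a) (B b c) =
        subst (coeffwise (lam (M := L)))
            (subst (coeffwise (lam (M := L)) + lam (M := ℕ →₀ L))
              (Finsupp.lsingle 0 ∘ₗ Finsupp.lsingle 0) ∘ₗ B.flip c) (B a b) +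
          subst (coeffwise (lam (M := L))) (coeffwise (Finsupp.lsingle 0) ∘ₗ B b) (B a c) := by
    rw [jacobiator_apply, sub_sub, sub_eq_zero, swapVar_eq_subst, jacobiLeft_apply,
      jacobiLeft_apply, subst_coeffwise, add_comm (coeffwise lam)]
    rfl
  simp only [hjacobi]
  exact ⟨fun h => ⟨⟨⟨h.sesq_left, h.sesq_right⟩, h.skew⟩, h.jacobi⟩,
    fun h => ⟨h.1.sesq_left, h.1.sesq_right, h.1.skew, h.2⟩⟩

theorem IsSkewSesquilinear.bracketR (hB : IsSkewSesquilinear B) {R : L →ₗ[ℂ] L}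
    (hR : ∀ a, R (transl L a) = transl L (R a)) : IsSkewSesquilinear (bracketR B R) where
  sesq_left a c := by simp only [bracketR_apply, hR, hB.sesq_left, map_add, neg_add]
  sesq_right a c := by simp only [bracketR_apply, hR, hB.sesq_right, map_add]
  skew a c := by
    rw [bracketR_apply, bracketR_apply, hB.skew (R a) c, hB.skew a (R c), map_add]
    abel

theorem ModifiedCYBE.isClassicalRMatrix {R : L →ₗ[ℂ] L} {κ : ℂ} (h : ModifiedCYBE κ B R)
    (hB : IsLieConformal B) (hR : ∀ a, R (transl L a) = transl L (R a)) :
    IsClassicalRMatrix B R := by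
  obtain ⟨hskew, hjacobi⟩ := isLieConformal_iff_jacobiator_eq_zero.1 hB
  refine isLieConformal_iff_jacobiator_eq_zero.2 ⟨hskew.bracketR hR, fun a b c => ?_⟩
  simp only [h.jacobiator_bracketR, hjacobi, add_zero, smul_zero]

namespace IsSesquilinear

variable (hB : IsSesquilinear B)
include hB

theorem jacobiLeft_transl (a : L) (q : ℕ →₀ L) :
    jacobiLeft B (transl L a) q = -coeffwise lam (jacobiLeft B a q) := by
  ext n
  simp [jacobiLeft_apply, coeffwise_apply, hB.sesq_left]

theorem jacobiLeft_lamAdd (a : L) (q : ℕ →₀ L) :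
    jacobiLeft B a (lamAdd (transl L) q) = lamAdd (lamAdd (transl L)) (jacobiLeft B a q) :=
  coeffwise_lamAdd_of_comm (hB.sesq_right a) q

theorem bracketSum_transl_left (c x : L) :
    bracketSum B c (transl L x) = -lamAdd lam (bracketSum B c x) := by
  simp [bracketSum_apply, hB.sesq_left, subst_lam]

theorem bracketSum_transl_right (c x : L) :
    bracketSum B (transl L c) x = lamAdd (lamAdd (transl L)) (bracketSum B c x) := by
  rw [bracketSum_apply, bracketSum_apply, hB.sesq_right, lamAdd_lamAdd]
  refine subst_lamAdd_of_comm (D := coeffwise (coeffwise (transl L)))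
    (coeffwise_lamAdd_of_comm fun x => (lam_coeffwise _ x).symm) (fun m => ?_) _
  simp [coeffwise_single]

theorem jacobiMid_transl (c : L) (q : ℕ →₀ L) :
    jacobiMid B (transl L c) q = lamAdd (lamAdd (transl L)) (jacobiMid B c q) := by
  have hsum : bracketSum B (transl L c) = lamAdd (lamAdd (transl L)) ∘ₗ bracketSum B c :=
    LinearMap.ext (hB.bracketSum_transl_right c)
  rw [jacobiMid_apply, hsum]
  exact (map_subst (fun p => (coeffwise_lamAdd_of_comm (lam_lamAdd (transl L)) p).symm) _ q).symm

theorem jacobiMid_lamAdd (c : L) (q : ℕ →₀ L) :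
    jacobiMid B c (lamAdd (transl L) q) = -lam (jacobiMid B c q) := by
  have hcomm (p : ℕ →₀ ℕ →₀ L) :
      (-lamAdd lam) (coeffwise lam p) = coeffwise lam ((-lamAdd lam) p) := by
    simp [lamAdd, lam_coeffwise]
  refine (subst_lamAdd_of_comm hcomm (hB.bracketSum_transl_left c) q).trans ?_
  simp [lamAdd, jacobiMid_apply]

theorem jacobiMid_negLamSub (c : L) (q : ℕ →₀ L) :
    jacobiMid B c (negLamSub (transl L) q) = swapVar L (jacobiMid B c q) := by
  have hl : jacobiMid B c (negLamSub (transl L) q) =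
      subst lam (jacobiMid B c ∘ₗ Finsupp.lsingle 0) q :=
    map_subst (fun p => by simp [hB.jacobiMid_lamAdd]) (Finsupp.lsingle 0) q
  have hr : swapVar L (jacobiMid B c q) =
      subst lam ((swapVar L).toLinearMap ∘ₗ bracketSum B c) q :=
    map_subst (g := (swapVar L).toLinearMap) swapVar_coeffwise_lam (bracketSum B c) q
  have hj : jacobiMid B c ∘ₗ Finsupp.lsingle 0 =
      (swapVar L).toLinearMap ∘ₗ bracketSum B c := by
    ext1 x
    simp [jacobiMid_apply, subst_single, swapVar_bracketSum]
  rw [hl, hr, hj]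

theorem jacobiator_transl_left (a b c : L) :
    jacobiator B (transl L a) b c = -coeffwise lam (jacobiator B a b c) := by
  have hlam : jacobiLeft B b (lam (B a c)) = lam (jacobiLeft B b (B a c)) :=
    (lam_coeffwise (B b) _).symm
  have hlam' : jacobiMid B c (lam (B a b)) = coeffwise lam (jacobiMid B c (B a b)) :=
    subst_lam _ _ _
  simp only [jacobiator_apply, hB.jacobiLeft_transl, hB.sesq_left, map_neg, hlam, hlam',
    swapVar_lam, map_sub]
  abel

theorem jacobiator_transl_right (a b c : L) :
    jacobiator B a b (transl L c) = lamAdd (lamAdd (transl L)) (jacobiator B a b c) := by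
  simp only [jacobiator_apply, hB.sesq_right, hB.jacobiLeft_lamAdd, hB.jacobiMid_transl,
    swapVar_lamAdd_lamAdd, map_sub]

end IsSesquilinear

namespace IsSkewSesquilinear

variable (hB : IsSkewSesquilinear B)
include hB

theorem jacobiator_swap (a b c : L) :
    jacobiator B b a c = -swapVar L (jacobiator B a b c) := by
  have hmid : jacobiMid B c (B b a) = -swapVar L (jacobiMid B c (B a b)) := by
    rw [hB.skew a b, map_neg, hB.jacobiMid_negLamSub]
  simp only [jacobiator_apply, hmid, map_sub, swapVar_swapVar]
  abel

theorem jacobiator_transl_mid (a b c : L) :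
    jacobiator B a (transl L b) c = -lam (jacobiator B a b c) := by
  rw [hB.jacobiator_swap (transl L b) a c, hB.jacobiator_transl_left, map_neg, neg_neg,
    swapVar_coeffwise_lam, hB.jacobiator_swap a b c, map_neg, swapVar_swapVar, map_neg]

theorem isLieConformal_iff_basis {ι : Type*} (b : Module.Basis ι ℂ[X] L) :
    IsLieConformal B ↔ ∀ α β γ, jacobiator B (b α) (b β) (b γ) = 0 := by
  refine ⟨fun h α β γ => (isLieConformal_iff_jacobiator_eq_zero.1 h).2 _ _ _, fun h => ?_⟩
  have hright {a x : L} (hax : ∀ γ, jacobiator B a x (b γ) = 0) : jacobiator B a x = 0 :=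
    ext_of_transl b (lamAdd (lamAdd (transl L))) (hB.jacobiator_transl_right a x) (by simp) hax
  have hmid {a : L} (ha : ∀ β, jacobiator B a (b β) = 0) : jacobiator B a = 0 := by
    refine ext_of_transl b (fun f => -(lam ∘ₗ f)) (fun x => ?_) (by simp) ha
    ext1 c
    simp [hB.jacobiator_transl_mid]
  have hbasis (α : ι) : jacobiator B (b α) = 0 := hmid fun β => hright (h α β)
  have hzero (a : L) : jacobiator B a = 0 := by
    refine hmid fun β => ?_
    ext1 c
    simp [hB.jacobiator_swap (b β) a c, hbasis]
  exact isLieConformal_iff_jacobiator_eq_zero.2 ⟨hB, by simp [hzero]⟩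

end IsSkewSesquilinear

end SkewSesquilinear

/-! ### The symmetric algebra and the Master Formula -/

section Generators

variable {L : Type*} [AddCommGroup L] [Module ℂ L] [Module ℂ[X] L] [IsScalarTower ℂ ℂ[X] L]
  {N : ℕ} (b : Module.Basis (Fin N) ℂ[X] L)

theorem jetEmb_jetBasis (i : Fin N × ℕ) : jetEmb b (jetBasis b i) = MvPolynomial.X i := by
  classical
  obtain ⟨α, n⟩ := i
  have hcoord (β : Fin N) :
      (Polynomial.basisMonomials ℂ).constr ℂ (fun n => (MvPolynomial.X (β, n) : ArcAlg N))
        (b.coord β (jetBasis b (α, n))) = if β = α then MvPolynomial.X (α, n) else 0 := by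
    rw [jetBasis_apply, map_smul, Module.Basis.coord_apply, Module.Basis.repr_self]
    split_ifs with hβ
    · subst hβ
      have hX : (Polynomial.X : ℂ[X]) ^ n = Polynomial.basisMonomials ℂ n := by
        rw [Polynomial.coe_basisMonomials, Polynomial.X_pow_eq_monomial]
      rw [Finsupp.single_eq_same, smul_eq_mul, mul_one, hX, Module.Basis.constr_basis]
    · rw [Finsupp.single_eq_of_ne hβ, smul_zero, map_zero]
  simp only [jetEmb, LinearMap.sum_apply, LinearMap.comp_apply, LinearMap.restrictScalars_apply,
    hcoord, Finset.sum_ite_eq', Finset.mem_univ, if_true]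

theorem jetEmb_basis (α : Fin N) : jetEmb b (b α) = MvPolynomial.X (α, 0) := by
  rw [← jetBasis_zero, jetEmb_jetBasis]

theorem jetEmb_transl (a : L) : jetEmb b (transl L a) = arcDer N (jetEmb b a) := by
  have h : jetEmb b ∘ₗ transl L = (arcDer N).toLinearMap ∘ₗ jetEmb b := by
    refine (jetBasis b).ext fun ⟨α, n⟩ => ?_
    simp [transl_jetBasis, jetEmb_jetBasis, arcDer]
  exact DFunLike.congr_fun h a

theorem jetEmb_injective : Function.Injective (jetEmb b) := by
  have h : jetEmb b = (Finsupp.linearCombination ℂ (MvPolynomial.X : _ → ArcAlg N)) ∘ₗ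
      (jetBasis b).repr.toLinearMap :=
    (jetBasis b).ext fun i => by simp [jetEmb_jetBasis]
  rw [h, LinearMap.coe_comp]
  have hX : Function.Injective (Finsupp.linearCombination ℂ
      (MvPolynomial.X : Fin N × ℕ → ArcAlg N)) := MvPolynomial.linearIndependent_X _ ℂ
  exact hX.comp (jetBasis b).repr.injective

theorem symDer_ι (a : L) :
    symDer L (SymmetricAlgebra.ι ℂ L a) = SymmetricAlgebra.ι ℂ L (transl L a) := by
  simp [symDer, symDual]

theorem exists_symmetricAlgebra_equiv_arcAlg :
    ∃ e : SymmetricAlgebra ℂ L ≃ₐ[ℂ] ArcAlg N,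
      (∀ a, e (SymmetricAlgebra.ι ℂ L a) = jetEmb b a) ∧
      ∀ v, e (symDer L v) = arcDer N (e v) := by
  let e := SymmetricAlgebra.equivMvPolynomial (jetBasis b)
  have he (a : L) : e (SymmetricAlgebra.ι ℂ L a) = jetEmb b a := by
    have h : e.toLinearMap ∘ₗ SymmetricAlgebra.ι ℂ L = jetEmb b :=
      (jetBasis b).ext fun i => by
        rw [jetEmb_jetBasis]
        exact SymmetricAlgebra.equivMvPolynomial_ι_apply (jetBasis b) i
    exact DFunLike.congr_fun h a
  refine ⟨e, he, fun v => ?_⟩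
  induction v using SymmetricAlgebra.induction with
  | algebraMap r => simp
  | ι a => rw [symDer_ι, he, he, jetEmb_transl]
  | mul x y hx hy => simp [Derivation.leibniz, hx, hy]
  | add x y hx hy => simp [hx, hy]

end Generators

section MasterFormula

variable {S : Type*} [Ring S] [Algebra ℂ S]

theorem negLamSub_single_zero {M : Type*} [AddCommGroup M] [Module ℂ M] (d : M →ₗ[ℂ] M) (m : M) :
    negLamSub d (Finsupp.single 0 m) = Finsupp.single 0 m := by
  simp [negLamSub, subst_single]

theorem lamAdd_pow_single_zero_one {d : S →ₗ[ℂ] S} (hd : d 1 = 0) (n : ℕ) :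
    (lamAdd d ^ n) (Finsupp.single 0 1) = Finsupp.single n 1 := by
  induction n with
  | zero => simp
  | succ n ih => simp [pow_succ', ih, lamAdd_single, hd]

theorem actOn_one_left {d : S →ₗ[ℂ] S} (hd : d 1 = 0) (q : ℕ →₀ S) :
    actOn d (Finsupp.single 0 1) q = q := by
  induction q using Finsupp.induction_linear with
  | zero => simp
  | add p q hp hq => simp only [map_add, hp, hq]
  | single n h => simp [actOn_single, lamAdd_pow_single_zero_one hd, coeffwise_single]

theorem actOn_one_right (d : S →ₗ[ℂ] S) (q : ℕ →₀ S) : actOn d q (Finsupp.single 0 1) = q := by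
  ext n
  simp [actOn_single, coeffwise_apply]

end MasterFormula

section PVABracket

variable {L : Type*} [AddCommGroup L] [Module ℂ L] [Module ℂ[X] L] [IsScalarTower ℂ ℂ[X] L]
  {N : ℕ}

theorem arcGrad_apply (σ : Fin N) (f : ArcAlg N) (n : ℕ) :
    arcGrad σ f n = MvPolynomial.pderiv (σ, n) f := rfl

theorem arcGrad_arcDer (σ : Fin N) (f : ArcAlg N) :
    arcGrad σ (arcDer N f) = lamAdd (arcDer N).toLinearMap (arcGrad σ f) := by
  ext1 n
  cases n <;>
    simp [arcGrad_apply, lamAdd, lam_zero, lam_succ, coeffwise_apply, pderiv_arcDer_zero,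
      pderiv_arcDer_succ, add_comm]

theorem arcGrad_X_zero (σ α : Fin N) :
    arcGrad σ (MvPolynomial.X (α, 0)) = if σ = α then Finsupp.single 0 1 else 0 := by
  ext1 n
  rw [arcGrad_apply, MvPolynomial.pderiv_X, Pi.single_apply]
  split_ifs <;> simp_all [eq_comm]

variable (B : L →ₗ[ℂ] L →ₗ[ℂ] (ℕ →₀ L)) (b : Module.Basis (Fin N) ℂ[X] L)

/-- `pvaBracket B b` as a bilinear map. -/
def pvaBracketHom : ArcAlg N →ₗ[ℂ] ArcAlg N →ₗ[ℂ] (ℕ →₀ ArcAlg N) :=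
  ∑ α, ∑ β, (actOn (arcDer N).toLinearMap).compl₁₂
    ((actOn (arcDer N).toLinearMap).flip (coeffwise (jetEmb b) (B (b α) (b β))) ∘ₗ
      negLamSub (arcDer N).toLinearMap ∘ₗ arcGrad α)
    (arcGrad β)

theorem pvaBracketHom_apply (f g : ArcAlg N) : pvaBracketHom B b f g = pvaBracket B b f g := by
  simp [pvaBracketHom, pvaBracket, LinearMap.sum_apply]

theorem pvaBracket_arcDer_left (f g : ArcAlg N) :
    pvaBracket B b (arcDer N f) g = -lam (pvaBracket B b f g) := by
  simp only [pvaBracket, arcGrad_arcDer, negLamSub_lamAdd, map_neg, LinearMap.neg_apply, actOn_lam,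
    map_sum, Finset.sum_neg_distrib]

theorem pvaBracket_arcDer_right (f g : ArcAlg N) :
    pvaBracket B b f (arcDer N g) = lamAdd (arcDer N).toLinearMap (pvaBracket B b f g) := by
  have hd (x y : ArcAlg N) : (arcDer N).toLinearMap (x * y) =
      x * (arcDer N).toLinearMap y + (arcDer N).toLinearMap x * y := by
    simp [mul_comm]
  simp only [pvaBracket, arcGrad_arcDer, actOn_lamAdd _ hd, map_sum]

theorem pvaBracket_X_zero (α β : Fin N) :
    pvaBracket B b (MvPolynomial.X (α, 0)) (MvPolynomial.X (β, 0)) =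
      coeffwise (jetEmb b) (B (b α) (b β)) := by
  have hd : (arcDer N).toLinearMap 1 = 0 := by simp
  rw [pvaBracket, Finset.sum_eq_single α, Finset.sum_eq_single β]
  · simp [arcGrad_X_zero, actOn_one_left hd, actOn_one_right, negLamSub_single_zero]
  · intro γ _ hγ
    simp [arcGrad_X_zero, hγ]
  · simp
  · intro γ _ hγ
    simp [arcGrad_X_zero, hγ]
  · simp

variable {B}

theorem IsSesquilinear.pvaBracket_jetEmb (hB : IsSesquilinear B) (a c : L) :
    pvaBracket B b (jetEmb b a) (jetEmb b c) = coeffwise (jetEmb b) (B a c) := by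
  suffices h : (pvaBracketHom B b).compl₁₂ (jetEmb b) (jetEmb b) =
      B.compr₂ (coeffwise (jetEmb b)) by
    simpa [pvaBracketHom_apply] using LinearMap.congr_fun₂ h a c
  refine ext_of_transl b (fun f => -(lam ∘ₗ f)) (fun a => ?_) (fun a => ?_) fun α => ?_
  · ext1 c
    simp [pvaBracketHom_apply, jetEmb_transl, pvaBracket_arcDer_left]
  · ext1 c
    simp [hB.sesq_left, lam_coeffwise]
  refine ext_of_transl b (lamAdd (arcDer N).toLinearMap) (fun c => ?_) (fun c => ?_) fun β => ?_
  · simp [pvaBracketHom_apply, jetEmb_transl, pvaBracket_arcDer_right]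
  · simp [hB.sesq_right, coeffwise_lamAdd_of_comm (d' := (arcDer N).toLinearMap) (jetEmb_transl b)]
  · simp [pvaBracketHom_apply, jetEmb_basis, pvaBracket_X_zero]

end PVABracket

/-! ### Differential operators -/

section DifferentialOperators

variable {M : Type*} [AddCommGroup M] [Module ℂ M]

theorem negLamSub_apply_zero (d : M →ₗ[ℂ] M) (p : ℕ →₀ M) :
    negLamSub d p 0 = subst (-d) LinearMap.id p := by
  have hid : Finsupp.lapply 0 ∘ₗ Finsupp.lsingle 0 = (LinearMap.id : M →ₗ[ℂ] M) := by
    ext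
    simp
  rw [← hid]
  exact map_subst (g := Finsupp.lapply 0) (fun q => by simp [lamAdd_apply_zero]) _ p

variable {S : Type*} [Ring S] [Algebra ℂ S]

/-- The application `∑ λ ^ n hₙ ↦ ∑ (d ^ n x) hₙ` of a differential operator, with coefficients
written on the right, to `x`. -/
def jetMul (d : S →ₗ[ℂ] S) (x : S) : (ℕ →₀ S) →ₗ[ℂ] S :=
  Finsupp.lsum ℂ fun n => LinearMap.mulLeft ℂ ((d ^ n) x)

/-- The application `∑ λ ^ n cₙ ↦ ∑ j(cₙ) (d ^ n x)` to `x` of a differential operator whose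
coefficients are mapped to `S` by `j`. -/
def applyTo (d : S →ₗ[ℂ] S) (j : M →ₗ[ℂ] S) (x : S) : (ℕ →₀ M) →ₗ[ℂ] S :=
  Finsupp.lsum ℂ fun n => LinearMap.mulRight ℂ ((d ^ n) x) ∘ₗ j

/-- The application `∑ λ ^ n cₙ ↦ ∑ (-d) ^ n (j(cₙ) x)` to `x` of the formal adjoint of the
differential operator of `applyTo`. -/
def adjointTo (d : S →ₗ[ℂ] S) (j : M →ₗ[ℂ] S) (x : S) : (ℕ →₀ M) →ₗ[ℂ] S :=
  subst (-d) (LinearMap.mulRight ℂ x ∘ₗ j)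

/-- The application `∑ λ ^ n μ ^ m c ↦ ∑ j(c) (d ^ n x) (d ^ m y)` of a bidifferential operator. -/
def applyTo₂ (d : S →ₗ[ℂ] S) (j : M →ₗ[ℂ] S) (x y : S) : (ℕ →₀ ℕ →₀ M) →ₗ[ℂ] S :=
  applyTo d (applyTo d j x) y

section JetMul

variable (d : S →ₗ[ℂ] S)

theorem jetMul_single (x : S) (n : ℕ) (h : S) :
    jetMul d x (Finsupp.single n h) = (d ^ n) x * h := by
  simp [jetMul]

theorem actOn_apply_zero (w q : ℕ →₀ S) : actOn d w q 0 = jetMul d (w 0) q := by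
  induction q using Finsupp.induction_linear with
  | zero => simp
  | add p q hp hq => simp only [map_add, Finsupp.add_apply, hp, hq]
  | single n h =>
    have hpow : ((lamAdd d ^ n) w) 0 = (d ^ n) (w 0) :=
      map_pow_of_comm (g := Finsupp.lapply 0) (lamAdd_apply_zero d) n w
    rw [actOn_single, jetMul_single, coeffwise_apply, hpow, LinearMap.mulRight_apply]

theorem jetMul_coeffwise_mulRight (x y : S) (q : ℕ →₀ S) :
    jetMul d x (coeffwise (LinearMap.mulRight ℂ y) q) = jetMul d x q * y := by
  induction q using Finsupp.induction_linear with
  | zero => simp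
  | add p q hp hq => simp only [map_add, add_mul, hp, hq]
  | single n h => simp [coeffwise_single, jetMul_single, mul_assoc, -Finsupp.single_mul]

theorem jetMul_coeffwise_mulLeft {d : S →ₗ[ℂ] S} {x y z : S}
    (h : ∀ n, (d ^ n) x * y = z * (d ^ n) x) (q : ℕ →₀ S) :
    jetMul d x (coeffwise (LinearMap.mulLeft ℂ y) q) = z * jetMul d x q := by
  induction q using Finsupp.induction_linear with
  | zero => simp
  | add p q hp hq => simp only [map_add, mul_add, hp, hq]
  | single n g =>
    rw [coeffwise_single, jetMul_single, jetMul_single, LinearMap.mulLeft_apply, ← mul_assoc, h,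
      mul_assoc]

end JetMul

section Leibniz

variable {d : S →ₗ[ℂ] S} (hd : ∀ x y, d (x * y) = x * d y + d x * y)
include hd

theorem jetMul_lamAdd (x : S) (q : ℕ →₀ S) : jetMul d x (lamAdd d q) = d (jetMul d x q) := by
  induction q using Finsupp.induction_linear with
  | zero => simp
  | add p q hp hq => simp only [map_add, hp, hq]
  | single n h =>
    rw [lamAdd_single, map_add, jetMul_single, jetMul_single, jetMul_single, hd, pow_succ',
      Module.End.mul_apply, add_comm]

theorem map_pow_mul_eq_map_mul_neg_pow {W : Type*} [AddCommGroup W] [Module ℂ W]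
    {g : S →ₗ[ℂ] W} (hg : ∀ x, g (d x) = 0) (n : ℕ) (x y : S) :
    g ((d ^ n) x * y) = g (x * ((-d) ^ n) y) := by
  have hparts (x y : S) : g (d x * y) = g (x * (-d) y) := by
    rw [LinearMap.neg_apply, mul_neg, map_neg, eq_neg_iff_add_eq_zero, ← map_add, add_comm, ← hd,
      hg]
  induction n generalizing x with
  | zero => simp
  | succ n ih =>
    rw [pow_succ, pow_succ', Module.End.mul_apply, Module.End.mul_apply, ih, hparts]

theorem map_mul_subst_neg_eq_map_jetMul {W : Type*} [AddCommGroup W] [Module ℂ W]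
    {g : S →ₗ[ℂ] W} (hg : ∀ x, g (d x) = 0) (x : S) (q : ℕ →₀ S) :
    g (x * subst (-d) LinearMap.id q) = g (jetMul d x q) := by
  induction q using Finsupp.induction_linear with
  | zero => simp
  | add p q hp hq => simp only [map_add, mul_add, hp, hq]
  | single n y =>
    rw [subst_single, jetMul_single, map_pow_mul_eq_map_mul_neg_pow hd hg, LinearMap.id_apply]

theorem map_mem_center_of_leibniz {x : S} (hx : x ∈ Subalgebra.center ℂ S) :
    d x ∈ Subalgebra.center ℂ S := by
  rw [Subalgebra.mem_center_iff] at hx ⊢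
  intro y
  have h := congrArg d (hx y)
  rwa [hd, hd, hx (d y), add_comm (x * d y), add_right_cancel_iff] at h

theorem subst_neg_mem_center {q : ℕ →₀ S} (hq : ∀ n, q n ∈ Subalgebra.center ℂ S) :
    subst (-d) LinearMap.id q ∈ Subalgebra.center ℂ S := by
  simp only [subst, Finsupp.lsum_apply, LinearMap.comp_id]
  refine Subalgebra.sum_mem _ fun n _ => ?_
  exact Module.End.pow_apply_mem_of_forall_mem (p := (Subalgebra.center ℂ S).toSubmodule) n
    (fun x hx => neg_mem (map_mem_center_of_leibniz hd hx)) (q n) (hq n)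

end Leibniz

section ApplyTo

variable {d : S →ₗ[ℂ] S} {j : M →ₗ[ℂ] S}

theorem applyTo_single (x : S) (n : ℕ) (c : M) :
    applyTo d j x (Finsupp.single n c) = j c * (d ^ n) x := by
  simp [applyTo]

theorem adjointTo_single (x : S) (n : ℕ) (c : M) :
    adjointTo d j x (Finsupp.single n c) = ((-d) ^ n) (j c * x) := by
  simp [adjointTo, subst_single]

theorem applyTo_lam (x : S) (p : ℕ →₀ M) : applyTo d j x (lam p) = applyTo d j (d x) p := by
  induction p using Finsupp.induction_linear with
  | zero => simp
  | add p q hp hq => simp only [map_add, hp, hq]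
  | single n c => simp [lam_single, applyTo_single, pow_succ]

theorem applyTo_coeffwise {M' : Type*} [AddCommGroup M'] [Module ℂ M'] (f : M' →ₗ[ℂ] M) (x : S)
    (p : ℕ →₀ M') : applyTo d j x (coeffwise f p) = applyTo d (j ∘ₗ f) x p := by
  induction p using Finsupp.induction_linear with
  | zero => simp
  | add p q hp hq => simp only [map_add, hp, hq]
  | single n c => simp [coeffwise_single, applyTo_single]

theorem applyTo_mul_mem {x y : S} {V : Submodule ℂ S} (h : ∀ c n, j c * (d ^ n) x * y ∈ V)
    (p : ℕ →₀ M) : applyTo d j x p * y ∈ V := by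
  induction p using Finsupp.induction_linear with
  | zero => simp
  | add p q hp hq => simpa only [map_add, add_mul] using V.add_mem hp hq
  | single n c => simpa only [applyTo_single] using h c n

theorem applyTo_lamAdd (hd : ∀ x y, d (x * y) = x * d y + d x * y) {δ : M →ₗ[ℂ] M}
    (hj : ∀ c, j (δ c) = d (j c)) (x : S) (p : ℕ →₀ M) :
    applyTo d j x (lamAdd δ p) = d (applyTo d j x p) := by
  induction p using Finsupp.induction_linear with
  | zero => simp
  | add p q hp hq => simp only [map_add, hp, hq]
  | single n c =>
    rw [lamAdd_single, map_add, applyTo_single, applyTo_single, applyTo_single, hd, hj, pow_succ',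
      Module.End.mul_apply]

theorem applyTo_negLamSub (hd : ∀ x y, d (x * y) = x * d y + d x * y) {δ : M →ₗ[ℂ] M}
    (hj : ∀ c, j (δ c) = d (j c)) (x : S) (p : ℕ →₀ M) :
    applyTo d j x (negLamSub δ p) = adjointTo d j x p := by
  have hzero : applyTo d j x ∘ₗ Finsupp.lsingle 0 = LinearMap.mulRight ℂ x ∘ₗ j := by
    ext c
    simp [applyTo_single]
  rw [adjointTo, ← hzero]
  exact map_subst (fun q => by simp [applyTo_lamAdd hd hj]) _ p

theorem applyTo₂_single (x y : S) (m : ℕ) (p : ℕ →₀ M) :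
    applyTo₂ d j x y (Finsupp.single m p) = applyTo d j x p * (d ^ m) y :=
  applyTo_single y m p

theorem applyTo₂_lam (x y : S) (p : ℕ →₀ ℕ →₀ M) :
    applyTo₂ d j x y (lam p) = applyTo₂ d j x (d y) p :=
  applyTo_lam y p

theorem applyTo₂_coeffwise_lam (x y : S) (p : ℕ →₀ ℕ →₀ M) :
    applyTo₂ d j x y (coeffwise lam p) = applyTo₂ d j (d x) y p := by
  have hlam : applyTo d j x ∘ₗ lam = applyTo d j (d x) := LinearMap.ext (applyTo_lam x)
  rw [applyTo₂, applyTo_coeffwise, hlam, applyTo₂]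

theorem applyTo₂_swapVar {x y : S} (h : ∀ m n, (d ^ m) x * (d ^ n) y = -((d ^ n) y * (d ^ m) x))
    (p : ℕ →₀ ℕ →₀ M) : applyTo₂ d j x y (swapVar M p) = -applyTo₂ d j y x p := by
  have hcomp : applyTo₂ d j x y ∘ₗ (swapVar M).toLinearMap = -applyTo₂ d j y x := by
    ext m n c
    simp [swapVar_single, applyTo₂_single, applyTo_single, mul_assoc, h]
  exact DFunLike.congr_fun hcomp p

section Bracket

variable (B : M →ₗ[ℂ] M →ₗ[ℂ] (ℕ →₀ M))

theorem applyTo₂_bracketSum (hd : ∀ x y, d (x * y) = x * d y + d x * y) (x y : S) (a c : M) :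
    applyTo₂ d j x y (bracketSum B c a) = applyTo d j (x * y) (B a c) := by
  rw [bracketSum_apply]
  induction B a c using Finsupp.induction_linear with
  | zero => simp
  | add p q hp hq => simp only [map_add, hp, hq]
  | single n e =>
    induction n generalizing x y with
    | zero => simp [subst_single, applyTo₂_single, applyTo_single, mul_assoc]
    | succ n ih =>
      rw [← lam_single, subst_lam, lamAdd, LinearMap.add_apply, map_add, applyTo₂_lam,
        applyTo₂_coeffwise_lam, ← lamAdd, ih, ih, applyTo_lam, hd]
      simp only [applyTo_single, map_add, mul_add]

theorem applyTo₂_jacobiMid_single (hd : ∀ x y, d (x * y) = x * d y + d x * y) (x y : S) (n : ℕ)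
    (a c : M) : applyTo₂ d j x y (jacobiMid B c (Finsupp.single n a)) =
      applyTo d j ((d ^ n) x * y) (B a c) := by
  induction n generalizing x with
  | zero => simp [jacobiMid_apply, subst_single, applyTo₂_bracketSum B hd]
  | succ n ih =>
    rw [← lam_single, jacobiMid_apply, subst_lam, ← jacobiMid_apply, applyTo₂_coeffwise_lam, ih,
      pow_succ, Module.End.mul_apply]

theorem applyTo₂_jacobiLeft (x y : S) (a : M) (q : ℕ →₀ M) :
    applyTo₂ d j x y (jacobiLeft B a q) = applyTo d (applyTo d j x ∘ₗ B a) y q :=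
  applyTo_coeffwise (B a) y q

end Bracket

end ApplyTo

end DifferentialOperators

/-! ### Functions on the arc space of `T*[1]𝔸ᴺ` -/

section HatRelations

variable {N : ℕ}

-- The negation of a tensor product and the one of its ring structure are not reducibly equal, so
-- `rw` and `simp` do not apply the general lemmas here.
theorem hatAlg_neg_mul (x y : HatAlg N) : -x * y = -(x * y) := neg_mul x y

theorem hatAlg_mul_neg (x y : HatAlg N) : x * -y = -(x * y) := mul_neg x y

theorem hatAlg_mul_sub (x y z : HatAlg N) : x * (y - z) = x * y - x * z := mul_sub x y z

theorem commute_ofArc (p : ArcAlg N) (x : HatAlg N) : Commute (ofArc N p) x := by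
  induction x using TensorProduct.induction_on with
  | zero => exact Commute.zero_right _
  | add x y hx hy => exact hx.add_right hy
  | tmul x q => exact (Commute.one_left x).tmul (Commute.all p q)

theorem theta_mul_ofArc_mul (i : Fin N × ℕ) (p : ArcAlg N) (x : HatAlg N) :
    theta i * (ofArc N p * x) = ofArc N p * (theta i * x) :=
  (commute_ofArc p (theta i)).symm.left_comm x

theorem theta_mul_theta (i j : Fin N × ℕ) : theta i * theta j = -(theta j * theta i) := by
  rw [eq_neg_iff_add_eq_zero]
  simp only [theta, Algebra.TensorProduct.tmul_mul_tmul, ← TensorProduct.add_tmul, oddVar]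
  rw [ExteriorAlgebra.ι_add_mul_swap, TensorProduct.zero_tmul]

theorem commute_ι_mul_ι {K V : Type*} [CommRing K] [AddCommGroup V] [Module K V] (v w : V)
    (x : ExteriorAlgebra K V) :
    Commute (ExteriorAlgebra.ι K v * ExteriorAlgebra.ι K w) x := by
  have hanti (v w : V) : ExteriorAlgebra.ι K v * ExteriorAlgebra.ι K w =
      -(ExteriorAlgebra.ι K w * ExteriorAlgebra.ι K v) :=
    eq_neg_iff_add_eq_zero.2 (ExteriorAlgebra.ι_add_mul_swap v w)
  induction x using ExteriorAlgebra.induction with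
  | algebraMap r => exact Algebra.commute_algebraMap_right r _
  | ι u =>
    calc ExteriorAlgebra.ι K v * ExteriorAlgebra.ι K w * ExteriorAlgebra.ι K u
        = -(ExteriorAlgebra.ι K v * ExteriorAlgebra.ι K u * ExteriorAlgebra.ι K w) := by
          rw [mul_assoc, hanti w u, mul_neg, mul_assoc]
      _ = ExteriorAlgebra.ι K u * (ExteriorAlgebra.ι K v * ExteriorAlgebra.ι K w) := by
          rw [hanti v u, neg_mul, neg_neg, mul_assoc]
  | mul x y hx hy => exact hx.mul_right hy
  | add x y hx hy => exact hx.add_right hy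

theorem commute_theta_mul_theta (i j : Fin N × ℕ) (x : HatAlg N) :
    Commute (theta i * theta j) x := by
  rw [theta, theta, Algebra.TensorProduct.tmul_mul_tmul, one_mul]
  induction x using TensorProduct.induction_on with
  | zero => exact Commute.zero_right _
  | add x y hx hy => exact hx.add_right hy
  | tmul x q => exact (commute_ι_mul_ι _ _ x).tmul (Commute.one_left q)

theorem ofArc_mul_theta_mul_theta_mem_center (p : ArcAlg N) (i j : Fin N × ℕ) :
    ofArc N p * (theta i * theta j) ∈ Subalgebra.center ℂ (HatAlg N) :=
  Subalgebra.mem_center_iff.2 fun x =>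
    ((commute_ofArc p x).mul_left (commute_theta_mul_theta i j x)).symm.eq

theorem parity_ofArc_mul_theta_mul_theta (p : ArcAlg N) (i j : Fin N × ℕ) :
    parity N (ofArc N p * (theta i * theta j)) = ofArc N p * (theta i * theta j) := by
  have hι (w : (Fin N × ℕ) →₀ ℂ) :
      CliffordAlgebra.involute (ExteriorAlgebra.ι ℂ w) = -ExteriorAlgebra.ι ℂ w :=
    CliffordAlgebra.involute_ι w
  simp [theta, ofArc, parity, oddVar, hι]

theorem ofArc_mul_theta_mul_theta_mem_hatDeg (p : ArcAlg N) (i j : Fin N × ℕ) :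
    ofArc N p * (theta i * theta j) ∈ hatDeg N 2 := by
  have hmem : oddVar i * oddVar j ∈ ⋀[ℂ]^2 ((Fin N × ℕ) →₀ ℂ) := by
    rw [ExteriorAlgebra.exteriorPower, pow_two]
    exact Submodule.mul_mem_mul (LinearMap.mem_range_self _ _) (LinearMap.mem_range_self _ _)
  refine ⟨⟨_, hmem⟩ ⊗ₜ p, ?_⟩
  simp [theta, ofArc]

theorem hatDer_ofArc (p : ArcAlg N) : hatDer N (ofArc N p) = ofArc N (arcDer N p) := by
  have hone : oddDer N 1 = 0 := by simpa using oddDer_algebraMap (N := N) 1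
  simp [ofArc, hatDer_tmul, hone]

theorem hatDer_theta (α : Fin N) (n : ℕ) : hatDer N (theta (α, n)) = theta (α, n + 1) := by
  simp [theta, hatDer_tmul, oddVar, oddDer_ι, oddShift]

theorem hatDer_pow_theta (α : Fin N) (n : ℕ) : (hatDer N ^ n) (theta (α, 0)) = theta (α, n) := by
  induction n with
  | zero => simp
  | succ n ih => rw [pow_succ', Module.End.mul_apply, ih, hatDer_theta]

theorem dTheta_one (i : Fin N × ℕ) : dTheta i (1 : HatAlg N) = 0 := by
  have hone : dOdd i (1 : OddAlg N) = 0 := by simpa using dOdd_algebraMap i 1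
  rw [Algebra.TensorProduct.one_def, dTheta_tmul, hone, TensorProduct.zero_tmul]

theorem dTheta_ofArc_mul (i : Fin N × ℕ) (p : ArcAlg N) (x : HatAlg N) :
    dTheta i (ofArc N p * x) = ofArc N p * dTheta i x := by
  induction x using TensorProduct.induction_on with
  | zero => simp
  | add x y hx hy => simp only [mul_add, map_add, hx, hy]
  | tmul x q => simp [ofArc, dTheta_tmul]

theorem dTheta_theta_mul (i j : Fin N × ℕ) (x : HatAlg N) :
    dTheta i (theta j * x) = (if j = i then x else 0) - theta j * dTheta i x := by
  classical
  induction x using TensorProduct.induction_on with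
  | zero => simp
  | add x y hx hy =>
    simp only [mul_add, map_add, hx, hy]
    split_ifs <;> abel
  | tmul x q =>
    simp only [theta, Algebra.TensorProduct.tmul_mul_tmul, dTheta_tmul, oddVar, dOdd_ι_mul,
      TensorProduct.sub_tmul, one_mul, Finsupp.single_apply]
    split_ifs <;> simp

theorem dTheta_theta (i j : Fin N × ℕ) : dTheta i (theta j) = if j = i then 1 else 0 := by
  simpa [dTheta_one] using dTheta_theta_mul i j 1

theorem dTheta_dTheta_theta_mul_theta (i j k l : Fin N × ℕ) :
    dTheta j (dTheta i (theta k * theta l)) =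
      (if k = i ∧ l = j then 1 else 0) - (if k = j ∧ l = i then 1 else 0) := by
  rw [dTheta_theta_mul, dTheta_theta, map_sub, apply_ite (dTheta j), map_zero, dTheta_theta,
    mul_ite, mul_one, mul_zero, apply_ite (dTheta j), map_zero, dTheta_theta, ← ite_and, ← ite_and]
  exact congrArg _ (if_congr and_comm rfl rfl)

theorem dU_mul (i : Fin N × ℕ) (x y : HatAlg N) : dU i (x * y) = x * dU i y + dU i x * y := by
  induction x using TensorProduct.induction_on with
  | zero => simp
  | add x x' hx hx' => simp only [add_mul, map_add, hx, hx']; abel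
  | tmul x p =>
    induction y using TensorProduct.induction_on with
    | zero => simp
    | add y y' hy hy' => simp only [mul_add, map_add, hy, hy']; abel
    | tmul y q =>
      simp only [Algebra.TensorProduct.tmul_mul_tmul, dU_tmul, Derivation.leibniz,
        TensorProduct.tmul_add, smul_eq_mul, mul_comm q]

theorem dU_theta (i j : Fin N × ℕ) : dU i (theta j) = 0 := by
  simp [theta, dU_tmul]

theorem dU_ofArc (i : Fin N × ℕ) (p : ArcAlg N) :
    dU i (ofArc N p) = ofArc N (MvPolynomial.pderiv i p) := by
  simp [ofArc, dU_tmul]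

theorem gradTheta_apply (σ : Fin N) (f : HatAlg N) (n : ℕ) :
    gradTheta σ f n = dTheta (σ, n) f := rfl

theorem gradTheta_one (σ : Fin N) : gradTheta σ (1 : HatAlg N) = 0 := by
  ext1 n
  rw [gradTheta_apply, dTheta_one, Finsupp.coe_zero, Pi.zero_apply]

theorem gradTheta_ofArc_mul (σ : Fin N) (p : ArcAlg N) (x : HatAlg N) :
    gradTheta σ (ofArc N p * x) = coeffwise (LinearMap.mulLeft ℂ (ofArc N p)) (gradTheta σ x) := by
  ext1 n
  simp [gradTheta_apply, coeffwise_apply, dTheta_ofArc_mul]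

theorem gradTheta_theta_mul (σ : Fin N) (i : Fin N × ℕ) (x : HatAlg N) :
    gradTheta σ (theta i * x) = (if i.1 = σ then Finsupp.single i.2 x else 0) +
      coeffwise (LinearMap.mulLeft ℂ (-theta i)) (gradTheta σ x) := by
  classical
  ext1 n
  obtain ⟨α, k⟩ := i
  simp only [gradTheta_apply, coeffwise_apply, dTheta_theta_mul, Finsupp.add_apply,
    LinearMap.mulLeft_apply, Prod.mk.injEq, hatAlg_neg_mul, sub_eq_add_neg]
  split_ifs <;> simp_all

theorem gradTheta_theta (σ : Fin N) (i : Fin N × ℕ) :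
    gradTheta σ (theta i) = if i.1 = σ then Finsupp.single i.2 1 else 0 := by
  simpa [gradTheta_one] using gradTheta_theta_mul σ i 1

theorem gradU_apply (σ : Fin N) (f : HatAlg N) (n : ℕ) : gradU σ f n = dU (σ, n) f := rfl

theorem gradU_mul_of_dU_eq_zero (σ : Fin N) (f g : HatAlg N) (h : ∀ i, dU i g = 0) :
    gradU σ (f * g) = coeffwise (LinearMap.mulRight ℂ g) (gradU σ f) := by
  ext1 n
  simp [gradU_apply, coeffwise_apply, dU_mul, h]

theorem gradU_ofArc (σ : Fin N) (p : ArcAlg N) :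
    gradU σ (ofArc N p) = coeffwise (ofArc N).toLinearMap (arcGrad σ p) := by
  ext1 n
  simp [gradU_apply, coeffwise_apply, arcGrad_apply, dU_ofArc]

end HatRelations

/-! ### Variational derivatives -/

section Variational

variable {N : ℕ}

/-- The variational derivative `δ/δθ_σ = ∑ (-∂) ^ n ∂/∂θ_σ^{(n)}`. -/
def varTheta (σ : Fin N) : HatAlg N →ₗ[ℂ] HatAlg N :=
  subst (-hatDer N) LinearMap.id ∘ₗ gradTheta σ

/-- The variational derivative `δ/δu^σ = ∑ (-∂) ^ n ∂/∂u^{σ,(n)}`. -/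
def varU (σ : Fin N) : HatAlg N →ₗ[ℂ] HatAlg N :=
  subst (-hatDer N) LinearMap.id ∘ₗ gradU σ

/-- The part `∑ (∂ ^ n δf/δθ_σ) ∂/∂u^{σ,(n)}` in the even directions of the Hamiltonian vector field
of `∫ f`. -/
def evolutionaryField (f : HatAlg N) : HatAlg N →ₗ[ℂ] HatAlg N :=
  ∑ σ, jetMul (hatDer N) (varTheta σ f) ∘ₗ gradU σ

theorem evolutionaryField_apply (f g : HatAlg N) :
    evolutionaryField f g = ∑ σ, jetMul (hatDer N) (varTheta σ f) (gradU σ g) := by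
  simp only [evolutionaryField, LinearMap.sum_apply, LinearMap.comp_apply]

theorem evolutionaryField_hatDer (f g : HatAlg N) :
    evolutionaryField f (hatDer N g) = hatDer N (evolutionaryField f g) := by
  simp only [evolutionaryField_apply, gradU_hatDer, jetMul_lamAdd hatDer_mul, map_sum]

theorem evolutionaryField_mul_of_dU_eq_zero (f g h : HatAlg N) (hh : ∀ i, dU i h = 0) :
    evolutionaryField f (g * h) = evolutionaryField f g * h := by
  simp only [evolutionaryField_apply, gradU_mul_of_dU_eq_zero _ _ _ hh, jetMul_coeffwise_mulRight,
    Finset.sum_mul]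

theorem evolutionaryField_ofArc_X_zero (f : HatAlg N) (α : Fin N) :
    evolutionaryField f (ofArc N (MvPolynomial.X (α, 0))) = varTheta α f := by
  classical
  rw [evolutionaryField_apply, Finset.sum_eq_single α _ (by simp)]
  · simp [gradU_ofArc, arcGrad_X_zero, coeffwise_single, jetMul_single]
  · intro σ _ hσ
    simp [gradU_ofArc, arcGrad_X_zero, hσ]

theorem varTheta_hatDer (σ : Fin N) (f : HatAlg N) : varTheta σ (hatDer N f) = 0 := by
  rw [varTheta, LinearMap.comp_apply, gradTheta_hatDer, ← negLamSub_apply_zero, negLamSub_lamAdd,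
    Finsupp.neg_apply, lam_zero, neg_zero]

theorem integral_hatDer (f : HatAlg N) : integral N (hatDer N f) = 0 :=
  (Submodule.Quotient.mk_eq_zero _).2 ⟨f, rfl⟩

theorem functionalBracket_eq {f : HatAlg N} (hf : parity N f = f) (g : HatAlg N) :
    functionalBracket N (integral N f) (integral N g) =
      integral N (∑ σ, (varTheta σ f * varU σ g + varU σ f * varTheta σ g)) := by
  rw [functionalBracket_integral, chiralBracket_apply, Finsupp.finsetSum_apply, map_sum, map_sum]
  refine Finset.sum_congr rfl fun σ _ => ?_
  simp only [Finsupp.add_apply, actOn_apply_zero, bracketWithU, bracketWithTheta,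
    LinearMap.comp_apply, hf, negLamSub_apply_zero, map_add, varTheta, varU,
    map_mul_subst_neg_eq_map_jetMul hatDer_mul integral_hatDer]

theorem varU_mem_center {f : HatAlg N} (hf : f ∈ Subalgebra.center ℂ (HatAlg N)) (σ : Fin N) :
    varU σ f ∈ Subalgebra.center ℂ (HatAlg N) :=
  subst_neg_mem_center hatDer_mul fun n => map_mem_center_of_leibniz (dU_mul (σ, n)) hf

theorem varU_mul_comm {f : HatAlg N} (hf : f ∈ Subalgebra.center ℂ (HatAlg N)) (σ : Fin N)
    (g : HatAlg N) : varU σ f * g = g * varU σ f :=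
  (Subalgebra.mem_center_iff.1 (varU_mem_center hf σ) g).symm

theorem functionalBracket_comm {f g : HatAlg N} (hf : parity N f = f) (hg : parity N g = g)
    (hf' : f ∈ Subalgebra.center ℂ (HatAlg N)) (hg' : g ∈ Subalgebra.center ℂ (HatAlg N)) :
    functionalBracket N (integral N f) (integral N g) =
      functionalBracket N (integral N g) (integral N f) := by
  rw [functionalBracket_eq hf, functionalBracket_eq hg]
  congr 1
  refine Finset.sum_congr rfl fun σ _ => ?_
  rw [varU_mul_comm hf', varU_mul_comm hg', add_comm]

theorem functionalBracket_self {f : HatAlg N} (hf : parity N f = f)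
    (hf' : f ∈ Subalgebra.center ℂ (HatAlg N)) :
    functionalBracket N (integral N f) (integral N f) =
      (2 : ℂ) • integral N (evolutionaryField f f) := by
  rw [functionalBracket_eq hf, evolutionaryField_apply, map_sum, map_sum, Finset.smul_sum]
  refine Finset.sum_congr rfl fun σ _ => ?_
  rw [varU_mul_comm hf', ← two_smul ℂ, map_smul, varU, LinearMap.comp_apply,
    map_mul_subst_neg_eq_map_jetMul hatDer_mul integral_hatDer]

/-- The Euler operator `∑ θ_σ^{(n)} ∂/∂θ_σ^{(n)}`, which multiplies a function of degree `k` in the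
`θ_σ^{(n)}` by `k`. -/
def euler (N : ℕ) : HatAlg N →ₗ[ℂ] HatAlg N :=
  ∑ σ, jetMul (hatDer N) (theta (σ, 0)) ∘ₗ gradTheta σ

theorem euler_apply (f : HatAlg N) :
    euler N f = ∑ σ, jetMul (hatDer N) (theta (σ, 0)) (gradTheta σ f) := by
  simp only [euler, LinearMap.sum_apply, LinearMap.comp_apply]

theorem integral_euler (f : HatAlg N) :
    integral N (euler N f) = integral N (∑ σ, theta (σ, 0) * varTheta σ f) := by
  simp only [euler_apply, map_sum, varTheta, LinearMap.comp_apply,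
    map_mul_subst_neg_eq_map_jetMul hatDer_mul integral_hatDer]

theorem euler_one : euler N (1 : HatAlg N) = 0 := by
  simp only [euler_apply, gradTheta_one, map_zero, Finset.sum_const_zero]

theorem euler_theta_mul (i : Fin N × ℕ) (x : HatAlg N) :
    euler N (theta i * x) = theta i * x + theta i * euler N x := by
  classical
  have hanti (σ : Fin N) (n : ℕ) :
      (hatDer N ^ n) (theta (σ, 0)) * -theta i = theta i * (hatDer N ^ n) (theta (σ, 0)) := by
    rw [hatDer_pow_theta, hatAlg_mul_neg, ← theta_mul_theta]
  simp only [euler_apply, gradTheta_theta_mul, map_add, jetMul_coeffwise_mulLeft (hanti _),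
    Finset.sum_add_distrib, Finset.mul_sum, apply_ite (jetMul _ _), jetMul_single, map_zero,
    hatDer_pow_theta, Finset.sum_ite_eq, Finset.mem_univ, if_true]

theorem euler_ofArc_mul (p : ArcAlg N) (x : HatAlg N) :
    euler N (ofArc N p * x) = ofArc N p * euler N x := by
  have hcomm (σ : Fin N) (n : ℕ) : (hatDer N ^ n) (theta (σ, 0)) * ofArc N p =
      ofArc N p * (hatDer N ^ n) (theta (σ, 0)) :=
    (commute_ofArc p _).symm.eq
  simp only [euler_apply, gradTheta_ofArc_mul, jetMul_coeffwise_mulLeft (hcomm _), Finset.mul_sum]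

theorem euler_ofArc_mul_theta_mul_theta_mul_theta (p : ArcAlg N) (i j k : Fin N × ℕ) :
    euler N (ofArc N p * (theta i * (theta j * theta k))) =
      (3 : ℂ) • (ofArc N p * (theta i * (theta j * theta k))) := by
  have htheta : euler N (theta k) = theta k := by simpa [euler_one] using euler_theta_mul k 1
  simp only [euler_ofArc_mul, euler_theta_mul, htheta, mul_add]
  module

end Variational

/-! ### The Schouten bracket of the bivector -/

section Schouten

variable {L : Type*} [AddCommGroup L] [Module ℂ L] [Module ℂ[X] L] [IsScalarTower ℂ ℂ[X] L]
  {N : ℕ} (b : Module.Basis (Fin N) ℂ[X] L)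

/-- The embedding `jetEmb` of `L` in the functions on the arc space of `𝔸ᴺ`, with these regarded as
functions on the arc space of `T*[1]𝔸ᴺ`. -/
def hatEmb : L →ₗ[ℂ] HatAlg N := (ofArc N).toLinearMap ∘ₗ jetEmb b

theorem hatEmb_apply (x : L) : hatEmb b x = ofArc N (jetEmb b x) := rfl

theorem hatEmb_transl (x : L) : hatEmb b (transl L x) = hatDer N (hatEmb b x) := by
  rw [hatEmb_apply, hatEmb_apply, jetEmb_transl, hatDer_ofArc]

theorem hatEmb_injective : Function.Injective (hatEmb b) := by
  have hofArc : Function.Injective (ofArc N) :=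
    Algebra.TensorProduct.includeRight_injective
      (ExteriorAlgebra.algebraMap_leftInverse _).injective
  exact hofArc.comp (jetEmb_injective b)

variable (B : L →ₗ[ℂ] L →ₗ[ℂ] (ℕ →₀ L))

/-- The map `x ↦ ∑ {u^γ_∂ x}_→ θ_γ`. Its value at `u^σ` is half the variational derivative
`δP/δθ_σ` of the bivector. -/
def hamiltonian : L →ₗ[ℂ] HatAlg N :=
  ∑ γ, applyTo (hatDer N) (hatEmb b) (theta (γ, 0)) ∘ₗ B (b γ)

theorem hamiltonian_apply (x : L) :
    hamiltonian b B x = ∑ γ, applyTo (hatDer N) (hatEmb b) (theta (γ, 0)) (B (b γ) x) := by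
  simp only [hamiltonian, LinearMap.sum_apply, LinearMap.comp_apply]

theorem bivector_eq : bivector B b = ∑ α, ∑ β, theta (α, 0) *
    applyTo (hatDer N) (hatEmb b) (theta (β, 0)) (B (b β) (b α)) := by
  unfold bivector
  refine Finset.sum_congr rfl fun α _ => Finset.sum_congr rfl fun β _ => ?_
  rw [pvaBracket_X_zero]
  congr 1
  rw [coeffwise, Finsupp.mapRange.linearMap_apply, Finsupp.sum_mapRange_index (by simp)]
  simp only [applyTo, Finsupp.lsum_apply, hatDer_pow_theta]
  rfl

theorem bivector_mem {V : Submodule ℂ (HatAlg N)}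
    (h : ∀ p i j, ofArc N p * (theta i * theta j) ∈ V) : bivector B b ∈ V := by
  rw [bivector_eq]
  refine sum_mem fun α _ => sum_mem fun β _ => ?_
  induction B (b β) (b α) using Finsupp.induction_linear with
  | zero => simp
  | add p q hp hq => simpa only [map_add, mul_add] using V.add_mem hp hq
  | single n x =>
    rw [applyTo_single, hatDer_pow_theta, hatEmb_apply, theta_mul_ofArc_mul]
    exact h _ _ _

theorem bivector_mem_hatDeg : bivector B b ∈ hatDeg N 2 :=
  bivector_mem b B ofArc_mul_theta_mul_theta_mem_hatDeg

theorem parity_bivector : parity N (bivector B b) = bivector B b :=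
  LinearMap.mem_eqLocus.1 (bivector_mem b B (V := LinearMap.eqLocus (parity N) LinearMap.id)
    parity_ofArc_mul_theta_mul_theta)

theorem bivector_mem_center : bivector B b ∈ Subalgebra.center ℂ (HatAlg N) :=
  bivector_mem b B (V := (Subalgebra.center ℂ (HatAlg N)).toSubmodule)
    ofArc_mul_theta_mul_theta_mem_center

variable {B}

theorem IsSkewSesquilinear.adjointTo_eq (hB : IsSkewSesquilinear B) {S : Type*} [Ring S]
    [Algebra ℂ S] {d : S →ₗ[ℂ] S} (hd : ∀ x y, d (x * y) = x * d y + d x * y) {j : L →ₗ[ℂ] S}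
    (hj : ∀ c, j (transl L c) = d (j c)) (x : S) (a c : L) :
    adjointTo d j x (B a c) = -applyTo d j x (B c a) := by
  rw [hB.skew a c, map_neg, applyTo_negLamSub hd hj, neg_neg]

theorem IsSkewSesquilinear.hamiltonian_transl (hB : IsSkewSesquilinear B) (x : L) :
    hamiltonian b B (transl L x) = hatDer N (hamiltonian b B x) := by
  simp only [hamiltonian_apply, hB.sesq_right, applyTo_lamAdd hatDer_mul (hatEmb_transl b), map_sum]

theorem varTheta_theta_mul_applyTo (σ α β : Fin N) (p : ℕ →₀ L) :
    varTheta σ (theta (α, 0) * applyTo (hatDer N) (hatEmb b) (theta (β, 0)) p) =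
      (if α = σ then applyTo (hatDer N) (hatEmb b) (theta (β, 0)) p else 0) -
        (if β = σ then adjointTo (hatDer N) (hatEmb b) (theta (α, 0)) p else 0) := by
  induction p using Finsupp.induction_linear with
  | zero => simp
  | add p q hp hq =>
    simp only [map_add, mul_add, hp, hq]
    split_ifs <;> abel
  | single n x =>
    simp only [applyTo_single, adjointTo_single, hatDer_pow_theta, hatEmb_apply, varTheta,
      LinearMap.comp_apply, theta_mul_ofArc_mul, gradTheta_ofArc_mul, gradTheta_theta_mul,
      gradTheta_theta]
    split_ifs <;> simp [coeffwise_single, subst_single, sub_eq_add_neg, -Finsupp.single_mul]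

theorem IsSkewSesquilinear.varTheta_bivector (hB : IsSkewSesquilinear B) (σ : Fin N) :
    varTheta σ (bivector B b) = (2 : ℂ) • hamiltonian b B (b σ) := by
  classical
  rw [bivector_eq]
  simp only [map_sum, varTheta_theta_mul_applyTo, Finset.sum_sub_distrib]
  rw [Finset.sum_comm]
  simp only [Finset.sum_ite_eq', Finset.mem_univ, if_true,
    hB.adjointTo_eq hatDer_mul (hatEmb_transl b), Finset.sum_neg_distrib, sub_neg_eq_add,
    two_smul, hamiltonian_apply]

theorem IsSkewSesquilinear.evolutionaryField_bivector_hatEmb (hB : IsSkewSesquilinear B) (x : L) :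
    evolutionaryField (bivector B b) (hatEmb b x) = (2 : ℂ) • hamiltonian b B x := by
  have hext : evolutionaryField (bivector B b) ∘ₗ hatEmb b = (2 : ℂ) • hamiltonian b B := by
    refine ext_of_transl b (hatDer N) (fun a => ?_) (fun a => ?_) (fun α => ?_)
    · simp [hatEmb_transl, evolutionaryField_hatDer]
    · simp [hB.hamiltonian_transl]
    · rw [LinearMap.comp_apply, LinearMap.smul_apply, hatEmb_apply, jetEmb_basis,
        evolutionaryField_ofArc_X_zero, hB.varTheta_bivector]
  exact DFunLike.congr_fun hext x

theorem IsSkewSesquilinear.evolutionaryField_bivector_theta_mul_applyTo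
    (hB : IsSkewSesquilinear B) (α β : Fin N) (p : ℕ →₀ L) :
    evolutionaryField (bivector B b)
        (theta (α, 0) * applyTo (hatDer N) (hatEmb b) (theta (β, 0)) p) =
      (-2 : ℂ) • (applyTo (hatDer N) (hamiltonian b B) (theta (β, 0)) p * theta (α, 0)) := by
  induction p using Finsupp.induction_linear with
  | zero => simp
  | add p q hp hq => simp only [map_add, mul_add, add_mul, smul_add, hp, hq]
  | single n x =>
    have hdU (i : Fin N × ℕ) : dU i (theta (α, 0) * theta (β, n)) = 0 := by
      simp [dU_mul, dU_theta]
    have hcomm : theta (α, 0) * (hatEmb b x * theta (β, n)) =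
        hatEmb b x * (theta (α, 0) * theta (β, n)) :=
      theta_mul_ofArc_mul _ _ _
    rw [applyTo_single, applyTo_single, hatDer_pow_theta, hcomm,
      evolutionaryField_mul_of_dU_eq_zero _ _ _ hdU, hB.evolutionaryField_bivector_hatEmb,
      theta_mul_theta, hatAlg_mul_neg, smul_mul_assoc, mul_assoc]
    module

variable (B) in
/-- The trivector `∑ {u^γ_∂ {u^β_∂ u^α}}_→ θ_γ θ_β θ_α`, where the outer `∂` acts on `θ_γ` and
the inner one on `θ_β`. It represents `[∫ P, ∫ P]` up to a factor. -/
def trivector : HatAlg N := ∑ α, ∑ β,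
  applyTo (hatDer N) (hamiltonian b B) (theta (β, 0)) (B (b β) (b α)) * theta (α, 0)

theorem IsSkewSesquilinear.functionalBracket_bivector (hB : IsSkewSesquilinear B) :
    functionalBracket N (integral N (bivector B b)) (integral N (bivector B b)) =
      (-4 : ℂ) • integral N (trivector b B) := by
  have hfield : evolutionaryField (bivector B b) (bivector B b) = (-2 : ℂ) • trivector b B := by
    rw [congrArg (evolutionaryField (bivector B b)) (bivector_eq b B)]
    simp only [map_sum, hB.evolutionaryField_bivector_theta_mul_applyTo, trivector,
      Finset.smul_sum]
  rw [functionalBracket_self (parity_bivector b B) (bivector_mem_center b B), hfield, map_smul,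
    smul_smul]
  norm_num

theorem euler_trivector : euler N (trivector b B) = (3 : ℂ) • trivector b B := by
  suffices trivector b B ∈ LinearMap.eqLocus (euler N) ((3 : ℂ) • LinearMap.id) from this
  refine sum_mem fun α _ => sum_mem fun β _ => applyTo_mul_mem (fun x m => ?_) _
  rw [hamiltonian_apply, mul_assoc, Finset.sum_mul]
  refine sum_mem fun γ _ => applyTo_mul_mem (fun y n => ?_) _
  rw [mul_assoc, hatDer_pow_theta, hatDer_pow_theta]
  exact euler_ofArc_mul_theta_mul_theta_mul_theta _ _ _ _

theorem integral_trivector_eq_zero_iff :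
    integral N (trivector b B) = 0 ↔ ∀ ρ, varTheta ρ (trivector b B) = 0 := by
  constructor
  · intro h ρ
    obtain ⟨f, hf⟩ := (Submodule.Quotient.mk_eq_zero _).1 h
    rw [← hf, varTheta_hatDer]
  · intro h
    have heuler := integral_euler (trivector b B)
    simp only [h, mul_zero, Finset.sum_const_zero, map_zero, euler_trivector, map_smul] at heuler
    exact (smul_eq_zero.1 heuler).resolve_left (by norm_num)

theorem varTheta_applyTo_mul (ρ γ : Fin N) (j k : Fin N × ℕ) (p : ℕ →₀ L) :
    varTheta ρ (applyTo (hatDer N) (hatEmb b) (theta (γ, 0)) p * (theta j * theta k)) =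
      (if γ = ρ then adjointTo (hatDer N) (hatEmb b) (theta j * theta k) p else 0) -
        (if j.1 = ρ then ((-hatDer N) ^ j.2)
          (applyTo (hatDer N) (hatEmb b) (theta (γ, 0)) p * theta k) else 0) +
        (if k.1 = ρ then ((-hatDer N) ^ k.2)
          (applyTo (hatDer N) (hatEmb b) (theta (γ, 0)) p * theta j) else 0) := by
  induction p using Finsupp.induction_linear with
  | zero => simp
  | add p q hp hq =>
    simp only [map_add, add_mul, hp, hq]
    split_ifs <;> abel
  | single n x =>
    simp only [applyTo_single, adjointTo_single, hatDer_pow_theta, hatEmb_apply, varTheta,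
      LinearMap.comp_apply, mul_assoc, gradTheta_ofArc_mul, gradTheta_theta_mul, gradTheta_theta]
    split_ifs <;> simp [coeffwise_single, subst_single, hatAlg_neg_mul, sub_eq_add_neg, add_assoc,
      -Finsupp.single_mul]

theorem IsSkewSesquilinear.varTheta_hamiltonian_mul (hB : IsSkewSesquilinear B) (ρ : Fin N)
    (j k : Fin N × ℕ) (x : L) :
    varTheta ρ (hamiltonian b B x * (theta j * theta k)) =
      -applyTo (hatDer N) (hatEmb b) (theta j * theta k) (B x (b ρ)) -
        (if j.1 = ρ then ((-hatDer N) ^ j.2) (hamiltonian b B x * theta k) else 0) +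
        (if k.1 = ρ then ((-hatDer N) ^ k.2) (hamiltonian b B x * theta j) else 0) := by
  classical
  rw [hamiltonian_apply]
  simp only [Finset.sum_mul, map_sum, varTheta_applyTo_mul, Finset.sum_add_distrib,
    Finset.sum_sub_distrib, Finset.sum_ite_eq', Finset.mem_univ, if_true,
    hB.adjointTo_eq hatDer_mul (hatEmb_transl b)]
  split_ifs <;> simp

theorem IsSkewSesquilinear.varTheta_applyTo_hamiltonian (hB : IsSkewSesquilinear B)
    (ρ α β : Fin N) (q : ℕ →₀ L) :
    varTheta ρ (applyTo (hatDer N) (hamiltonian b B) (theta (β, 0)) q * theta (α, 0)) =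
      -applyTo₂ (hatDer N) (hatEmb b) (theta (β, 0)) (theta (α, 0)) (jacobiMid B (b ρ) q) -
        (if β = ρ then adjointTo (hatDer N) (hamiltonian b B) (theta (α, 0)) q else 0) +
        (if α = ρ then applyTo (hatDer N) (hamiltonian b B) (theta (β, 0)) q else 0) := by
  induction q using Finsupp.induction_linear with
  | zero => simp
  | add p q hp hq =>
    simp only [map_add, add_mul, hp, hq]
    split_ifs <;> abel
  | single n x =>
    rw [applyTo_single, applyTo₂_jacobiMid_single B hatDer_mul, hatDer_pow_theta, mul_assoc,
      hB.varTheta_hamiltonian_mul, adjointTo_single, pow_zero, Module.End.one_apply]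

theorem applyTo₂_theta_swapVar (γ β : Fin N) (p : ℕ →₀ ℕ →₀ L) :
    applyTo₂ (hatDer N) (hatEmb b) (theta (γ, 0)) (theta (β, 0)) (swapVar L p) =
      -applyTo₂ (hatDer N) (hatEmb b) (theta (β, 0)) (theta (γ, 0)) p :=
  applyTo₂_swapVar (fun m n => by rw [hatDer_pow_theta, hatDer_pow_theta, theta_mul_theta]) p

theorem sum_applyTo₂_jacobiLeft (β : Fin N) (q : ℕ →₀ L) :
    ∑ γ, applyTo₂ (hatDer N) (hatEmb b) (theta (γ, 0)) (theta (β, 0)) (jacobiLeft B (b γ) q) =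
      applyTo (hatDer N) (hamiltonian b B) (theta (β, 0)) q := by
  induction q using Finsupp.induction_linear with
  | zero => simp
  | add p q hp hq => simp only [map_add, Finset.sum_add_distrib, hp, hq]
  | single n x =>
    simp only [applyTo₂_jacobiLeft, applyTo_single, LinearMap.comp_apply, hamiltonian_apply,
      Finset.sum_mul]

theorem IsSkewSesquilinear.varTheta_trivector (hB : IsSkewSesquilinear B) (ρ : Fin N) :
    varTheta ρ (trivector b B) = ∑ γ, ∑ β,
      applyTo₂ (hatDer N) (hatEmb b) (theta (γ, 0)) (theta (β, 0))
        (jacobiator B (b γ) (b β) (b ρ)) := by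
  classical
  set A : Fin N → Fin N → (ℕ →₀ ℕ →₀ L) →ₗ[ℂ] HatAlg N := fun γ β =>
    applyTo₂ (hatDer N) (hatEmb b) (theta (γ, 0)) (theta (β, 0)) with hA
  set H : Fin N → Fin N → HatAlg N := fun α β =>
    applyTo (hatDer N) (hamiltonian b B) (theta (β, 0)) (B (b β) (b α)) with hH
  have houter : ∑ γ, ∑ β, A γ β (jacobiLeft B (b γ) (B (b β) (b ρ))) = ∑ β, H ρ β := by
    rw [Finset.sum_comm]
    exact Finset.sum_congr rfl fun β _ => sum_applyTo₂_jacobiLeft b β _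
  have hswap : ∑ γ, ∑ β, A γ β (swapVar L (jacobiLeft B (b β) (B (b γ) (b ρ)))) =
      -∑ β, H ρ β := by
    simp only [hA, applyTo₂_theta_swapVar, Finset.sum_neg_distrib, sum_applyTo₂_jacobiLeft, hH]
  have hderiv (α β : Fin N) :
      varTheta ρ (applyTo (hatDer N) (hamiltonian b B) (theta (β, 0)) (B (b β) (b α)) *
          theta (α, 0)) =
        -A β α (jacobiMid B (b ρ) (B (b β) (b α))) + (if β = ρ then H ρ α else 0) +
          (if α = ρ then H ρ β else 0) := by
    rw [hB.varTheta_applyTo_hamiltonian, hB.adjointTo_eq hatDer_mul (hB.hamiltonian_transl b)]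
    split_ifs <;> simp_all
  calc varTheta ρ (trivector b B)
      = -∑ α, ∑ β, A β α (jacobiMid B (b ρ) (B (b β) (b α))) + ∑ β, H ρ β + ∑ β, H ρ β := by
        simp only [trivector, map_sum, hderiv, Finset.sum_add_distrib, Finset.sum_neg_distrib,
          Finset.sum_ite_irrel, Finset.sum_ite_eq', Finset.sum_const_zero, Finset.mem_univ,
          if_true]
    _ = ∑ γ, ∑ β, A γ β (jacobiator B (b γ) (b β) (b ρ)) := by
        simp only [jacobiator_apply, map_sub, Finset.sum_sub_distrib, houter, hswap]
        rw [Finset.sum_comm]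
        abel

theorem dTheta_dTheta_applyTo₂ (γ β γ' β' : Fin N) (m n : ℕ) (p : ℕ →₀ ℕ →₀ L) :
    dTheta (β, m) (dTheta (γ, n)
        (applyTo₂ (hatDer N) (hatEmb b) (theta (γ', 0)) (theta (β', 0)) p)) =
      (if γ' = γ ∧ β' = β then hatEmb b (p m n) else 0) -
        (if γ' = β ∧ β' = γ then hatEmb b (p n m) else 0) := by
  induction p using Finsupp.induction_linear with
  | zero => simp
  | add p q hp hq =>
    simp only [map_add, hp, hq, Finsupp.add_apply]
    split_ifs <;> abel
  | single k p =>
    induction p using Finsupp.induction_linear with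
    | zero => simp
    | add p q hp hq =>
      simp only [map_add, hp, hq, Finsupp.add_apply, Finsupp.single_add]
      split_ifs <;> abel
    | single l x =>
      have hsingle (m n : ℕ) : Finsupp.single k (Finsupp.single l x) m n =
          if k = m ∧ l = n then x else 0 := by
        classical
        by_cases hk : k = m <;> simp [hk, Finsupp.single_apply]
      rw [applyTo₂_single, applyTo_single, hatDer_pow_theta, hatDer_pow_theta, mul_assoc,
        hatEmb_apply, dTheta_ofArc_mul, dTheta_ofArc_mul, dTheta_dTheta_theta_mul_theta]
      rw [hatAlg_mul_sub, mul_ite, mul_ite, mul_one, mul_zero, ← hatEmb_apply, hsingle, hsingle,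
        apply_ite (hatEmb b), apply_ite (hatEmb b), map_zero, ← ite_and, ← ite_and]
      congr 1 <;> refine if_congr ?_ rfl rfl <;> simp only [Prod.mk.injEq] <;> tauto

theorem IsSkewSesquilinear.sum_applyTo₂_jacobiator_eq_zero_iff (hB : IsSkewSesquilinear B)
    (ρ : Fin N) :
    ∑ γ, ∑ β, applyTo₂ (hatDer N) (hatEmb b) (theta (γ, 0)) (theta (β, 0))
      (jacobiator B (b γ) (b β) (b ρ)) = 0 ↔ ∀ γ β, jacobiator B (b γ) (b β) (b ρ) = 0 := by
  classical
  refine ⟨fun h γ β => ?_, fun h => by simp [h]⟩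
  ext m n
  have hcoeff := congrArg (fun f => dTheta (β, m) (dTheta (γ, n) f)) h
  simp only [map_sum, dTheta_dTheta_applyTo₂, map_zero, Finset.sum_sub_distrib] at hcoeff
  simp only [ite_and, Finset.sum_ite_eq', Finset.sum_ite_irrel, Finset.sum_const_zero,
    Finset.mem_univ, if_true, hB.jacobiator_swap (b γ) (b β) (b ρ), Finsupp.neg_apply,
    swapVar_apply, map_neg, sub_neg_eq_add, ← map_add] at hcoeff
  have htwo := hatEmb_injective b (hcoeff.trans (map_zero _).symm)
  rw [← two_smul ℂ] at htwo
  exact (smul_eq_zero.1 htwo).resolve_left two_ne_zero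

theorem IsSkewSesquilinear.isLieConformal_iff_functionalBracket (hB : IsSkewSesquilinear B) :
    IsLieConformal B ↔
      functionalBracket N (integral N (bivector B b)) (integral N (bivector B b)) = 0 := by
  rw [hB.functionalBracket_bivector, smul_eq_zero_iff_right (by norm_num),
    integral_trivector_eq_zero_iff, hB.isLieConformal_iff_basis b]
  simp only [hB.varTheta_trivector, hB.sum_applyTo₂_jacobiator_eq_zero_iff]
  exact ⟨fun h ρ γ β => h γ β ρ, fun h γ β ρ => h ρ γ β⟩

theorem bilin_sub_add_half_smul_bilin_sub {V W : Type*} [AddCommGroup V] [Module ℂ V]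
    [AddCommGroup W] [Module ℂ W] (β : V →ₗ[ℂ] V →ₗ[ℂ] W) {x y : V} (hx : β x x = 0)
    (hxy : β y x = β x y) :
    β x (y - x) + (1 / 2 : ℂ) • β (y - x) (y - x) = (1 / 2 : ℂ) • β y y := by
  simp only [map_sub, LinearMap.sub_apply, hx, hxy]
  module

theorem isMaurerCartan_bivector_sub_iff {B' : L →ₗ[ℂ] L →ₗ[ℂ] (ℕ →₀ L)}
    (hP : functionalBracket N (integral N (bivector B b)) (integral N (bivector B b)) = 0) :
    IsMaurerCartan (integral N (bivector B b)) (integral N (bivector B' b - bivector B b)) ↔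
      functionalBracket N (integral N (bivector B' b)) (integral N (bivector B' b)) = 0 := by
  have hdeg : integral N (bivector B' b - bivector B b) ∈ functionalDeg N 2 :=
    ⟨_, sub_mem (bivector_mem_hatDeg b B') (bivector_mem_hatDeg b B), rfl⟩
  have hcomm := functionalBracket_comm (parity_bivector b B') (parity_bivector b B)
    (bivector_mem_center b B') (bivector_mem_center b B)
  rw [IsMaurerCartan, and_iff_right hdeg, map_sub (integral N),
    bilin_sub_add_half_smul_bilin_sub _ hP hcomm, smul_eq_zero_iff_right (by norm_num)]

end Schouten

end ConformalR

end

open ConformalR in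
theorem mainTheorem3 {L : Type*} [AddCommGroup L] [Module ℂ L] [Module (Polynomial ℂ) L]
    [IsScalarTower ℂ (Polynomial ℂ) L]
    (B : L →ₗ[ℂ] L →ₗ[ℂ] (ℕ →₀ L)) (hB : IsLieConformal B)
    {N : ℕ} (b : Module.Basis (Fin N) (Polynomial ℂ) L)
    (R : L →ₗ[ℂ] L) (hR : ∀ a, R (transl L a) = transl L (R a)) :
    (∃ e : SymmetricAlgebra ℂ L ≃ₐ[ℂ] ArcAlg N,
      (∀ a, e (SymmetricAlgebra.ι ℂ L a) = jetEmb b a) ∧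
      ∀ v, e (symDer L v) = arcDer N (e v)) ∧
    (∀ a a', pvaBracket B b (jetEmb b a) (jetEmb b a') = coeffwise (jetEmb b) (B a a')) ∧
    (∀ κ : ℂ, ModifiedCYBE κ B R → IsClassicalRMatrix B R) ∧
    bivector (bracketR B R) b ∈ hatDeg N 2 ∧
    (IsClassicalRMatrix B R ↔
      functionalBracket N (integral N (bivector (bracketR B R) b))
        (integral N (bivector (bracketR B R) b)) = 0) ∧
    functionalBracket N (integral N (bivector B b)) (integral N (bivector B b)) = 0 ∧
    (IsClassicalRMatrix B R ↔
      IsMaurerCartan (integral N (bivector B b))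
        (integral N (bivector (bracketR B R) b - bivector B b))) := by
  have hS := (isLieConformal_iff_jacobiator_eq_zero.1 hB).1
  have hR_iff : IsClassicalRMatrix B R ↔ functionalBracket N
      (integral N (bivector (bracketR B R) b)) (integral N (bivector (bracketR B R) b)) = 0 :=
    (hS.bracketR hR).isLieConformal_iff_functionalBracket b
  have hP := (hS.isLieConformal_iff_functionalBracket b).1 hB
  exact ⟨exists_symmetricAlgebra_equiv_arcAlg b, hS.pvaBracket_jetEmb b,
    fun κ hκ => hκ.isClassicalRMatrix hB hR, bivector_mem_hatDeg b _, hR_iff, hP,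
    hR_iff.trans (isMaurerCartan_bivector_sub_iff b hP).symm⟩
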